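/- All graphs are finite, connected, loopless multigraphs (parallel edges are allowed and are counted in degrees). A scramble on $G$ is a nonempty collection $\mathcal S$ of nonempty connected subgraphs of $G$, called eggs. Its hitting number $h(\mathcal S)$ is the least size of a set of vertices that meets every egg. Its egg-cut number $e(\mathcal S)$ is the least number of edges whose deletion leaves two different components each containing an egg ($\infty$ if this is impossible). Its order is $\min\{h(\mathcal S),e(\mathcal S)\}$, and the scramble number $\mathrm{sn}(G)$ is the largest order of a scramble on $G$. **Corollary 6.5.** For all integers $r,\Delta\ge 0$ there is a constant $C=C(r,\Delta)$ such that every graph $G$ on $n$ vertices with no $K_r$ minor and with maximum degree at most $\Delta$ satisfies $\mathrm{sn}(G)\le C\sqrt n$. In particular: * for every $\Delta\ge 0$ there is a constant $C=C(\Delta)$ such that every planar graph $G$ on $n$ vertices with maximum degree at most $\Delta$ satisfies $\mathrm{sn}(G)\le C\sqrt n$; * for all integers $g,\Delta\ge 0$ there is a constant $C=C(g,\Delta)$ such that every graph $G$ on $n$ vertices with maximum degree at most $\Delta$ that can be embedded in a closed surface of genus at most $g$ satisfies $\mathrm{sn}(G)\le C\sqrt n$. Here the surface may be orientable, with genus its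 number of handles, or non-orientable, with genus its number of crosscaps. -/

import Mathlib

open scoped Graph

universe u v

noncomputable section

namespace Graph

variable {α : Type u} {β : Type v}

/-! ### Connectedness and degree -/

/-- `y` can be reached from `x` along edges of `G`. -/
def Reaches (G : Graph α β) (x y : α) : Prop := Relation.ReflTransGen G.Adj x y

/-- A connected graph: nonempty, and any two vertices are joined by a walk. -/
def Connected (G : Graph α β) : Prop :=
  V(G).Nonempty ∧ ∀ x ∈ V(G), ∀ y ∈ V(G), G.Reaches x y

/-- The number of edges at `x`, parallel edges counted separately. It is meant for loopless
graphs, the only ones considered here. -/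
def degree (G : Graph α β) (x : α) : ℕ∞ := (G.incidenceSet x).encard

/-- The standing convention: a finite, connected, loopless multigraph. -/
structure IsFiniteMultigraph (G : Graph α β) : Prop where
  finite_vertexSet : V(G).Finite
  finite_edgeSet : E(G).Finite
  loopless : G.Loopless
  connected : G.Connected

/-! ### Minors -/

open Classical in
/-- Merge `y` into `x`. The edges between `x` and `y`, which would become loops, are removed. -/
def contract (G : Graph α β) (x y : α) : Graph α β :=
  (G.deleteEdges {f | G.IsLink f x y}).map (fun z ↦ if z = y then x else z)

/-- One step in the formation of a minor: delete an edge, delete a vertex (with the edges at it),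
or contract an edge. -/
inductive MinorStep : Graph α β → Graph α β → Prop
  | deleteEdge (G : Graph α β) (e : β) : MinorStep G (G.deleteEdges {e})
  | deleteVertex (G : Graph α β) (x : α) : MinorStep G (G.deleteVerts {x})
  | contractEdge (G : Graph α β) (e : β) (x y : α) (h : G.IsLink e x y) :
      MinorStep G (G.contract x y)

/-- `H` is a minor of `G`. -/
def IsMinorOf (H G : Graph α β) : Prop := Relation.ReflTransGen MinorStep G H

/-- `H` is a complete graph `K_r`: simple, with `r` vertices, any two of them adjacent. -/
def IsCompleteOn (H : Graph α β) (r : ℕ) : Prop :=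
  H.Simple ∧ V(H).encard = r ∧ ∀ x ∈ V(H), ∀ y ∈ V(H), x ≠ y → H.Adj x y

/-- `G` has a `K_r` minor. -/
def HasCompleteMinor (G : Graph α β) (r : ℕ) : Prop :=
  ∃ H : Graph α β, H.IsMinorOf G ∧ H.IsCompleteOn r

/-! ### Scrambles -/

/-- A scramble: a nonempty collection of (nonempty) connected subgraphs, its eggs. -/
def IsScramble (G : Graph α β) (S : Set (Graph α β)) : Prop :=
  S.Nonempty ∧ ∀ H ∈ S, H ≤ G ∧ H.Connected

/-- The least number of vertices of `G` in a set that meets every egg. -/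
def hittingNumber (G : Graph α β) (S : Set (Graph α β)) : ℕ∞ :=
  ⨅ X ∈ {X : Set α | X ⊆ V(G) ∧ ∀ H ∈ S, (V(H) ∩ X).Nonempty}, X.encard

/-- An egg-cut: a set of edges after whose deletion two different components each contain
an egg. -/
def IsEggCut (G : Graph α β) (S : Set (Graph α β)) (A : Set β) : Prop :=
  A ⊆ E(G) ∧ ∃ H₁ ∈ S, ∃ H₂ ∈ S, H₁ ≤ G.deleteEdges A ∧ H₂ ≤ G.deleteEdges A ∧
    ∀ x ∈ V(H₁), ∀ y ∈ V(H₂), ¬ (G.deleteEdges A).Reaches x y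

/-- The least size of an egg-cut, `⊤` if there is none. -/
def eggCutNumber (G : Graph α β) (S : Set (Graph α β)) : ℕ∞ :=
  ⨅ A ∈ {A : Set β | G.IsEggCut S A}, A.encard

/-- The order of a scramble. -/
def scrambleOrder (G : Graph α β) (S : Set (Graph α β)) : ℕ∞ :=
  min (G.hittingNumber S) (G.eggCutNumber S)

/-- The scramble number: the largest order of a scramble. -/
def scrambleNumber (G : Graph α β) : ℕ∞ :=
  ⨆ S ∈ {S : Set (Graph α β) | G.IsScramble S}, G.scrambleOrder S

/-! ### Planar graphs -/

/-- A drawing without crossings of a loopless graph in the Euclidean plane: vertices are distinct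
points, an edge is a simple arc between its ends, and arcs meet vertices and each other
only at common ends. -/
structure PlaneDrawing (G : Graph α β) where
  point : α → EuclideanSpace ℝ (Fin 2)
  arc : β → C(unitInterval, EuclideanSpace ℝ (Fin 2))
  point_injOn : Set.InjOn point V(G)
  arc_injective : ∀ e ∈ E(G), Function.Injective (arc e)
  arc_ends : ∀ e ∈ E(G), ∃ x y, G.IsLink e x y ∧ arc e 0 = point x ∧ arc e 1 = point y
  arc_ne_point : ∀ e ∈ E(G), ∀ t, t ≠ 0 → t ≠ 1 → ∀ x ∈ V(G), arc e t ≠ point x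
  arc_ne_arc : ∀ e ∈ E(G), ∀ f ∈ E(G), e ≠ f → ∀ s, s ≠ 0 → s ≠ 1 → ∀ t, t ≠ 0 → t ≠ 1 →
    arc e s ≠ arc f t

/-- A planar graph. -/
def IsPlanar (G : Graph α β) : Prop := Nonempty G.PlaneDrawing

/-! ### Genus

A cellular embedding of a connected loopless graph in a closed surface is described
by its flags. Each edge `e` has four of them: a flag is an end `x` of `e` together with one of the
two sides of `e`. A flag is thus a corner of a face with a choice of one of the two edges that
bound this corner. -/

/-- The flags: an edge, one of its ends, one of its two sides. -/
def Flag (G : Graph α β) : Type (max u v) := {p : β × α × Bool // G.Inc p.1 p.2.1}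

namespace Flag

variable {G : Graph α β}

/-- The vertex of a flag. -/
def vertex (f : G.Flag) : α := f.1.2.1

/-- The flag at the other end of the edge, on the same side. -/
def flipEnd (f : G.Flag) : G.Flag := ⟨(f.1.1, f.2.other, f.1.2.2), f.2.inc_other⟩

/-- The flag at the same end of the edge, on the other side. -/
def flipSide (f : G.Flag) : G.Flag := ⟨(f.1.1, f.1.2.1, !f.1.2.2), f.2⟩

end Flag

/-- A cellular embedding of a connected loopless graph in a closed surface, orientable or not.
The map `turn` sends a flag to the other flag in the same corner, that is, it passes across a face
from one edge to the next edge around a vertex. Crossing faces (`turn`) and edges (`flipSide`)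
alternately, one goes round the vertex and meets all the flags there, so a neighbourhood of the
vertex is one disc. The surface arises from a disc for each cycle of `turn` and `flipEnd`. -/
structure CellularEmbedding (G : Graph α β) where
  turn : G.Flag → G.Flag
  turn_turn : ∀ f, turn (turn f) = f
  turn_ne : ∀ f, turn f ≠ f
  vertex_turn : ∀ f, (turn f).vertex = f.vertex
  around_vertex : ∀ f g : G.Flag, f.vertex = g.vertex →
    Relation.ReflTransGen (fun a b ↦ b = turn a ∨ b = a.flipSide) f g

namespace CellularEmbedding

variable {G : Graph α β} (M : G.CellularEmbedding)

/-- The faces that have an edge on their boundary: the orbits of flags under following an edge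
and turning in a corner. -/
def Face : Type (max u v) := Quot (fun a b : G.Flag ↦ b = M.turn a ∨ b = a.flipEnd)

open Classical in
/-- The number of faces. The one-vertex graph is embedded in the sphere, with one face. -/
def faceCount : ℕ := if E(G) = ∅ then 1 else Nat.card M.Face

/-- The Euler characteristic of the surface. -/
def eulerChar : ℤ := V(G).ncard - E(G).ncard + M.faceCount

/-- Orientability of the surface: the flags can be two-coloured so that neighbouring flags
have different colours. -/
def Orientable : Prop :=
  ∃ c : G.Flag → Bool, ∀ f, c (M.turn f) ≠ c f ∧ c f.flipEnd ≠ c f ∧ c f.flipSide ≠ c f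

open Classical in
/-- The genus of the surface: the number of handles if it is orientable, and the number of
crosscaps if it is not. -/
def genus : ℤ := if M.Orientable then (2 - M.eulerChar) / 2 else 2 - M.eulerChar

end CellularEmbedding

/-- `G` has genus at most `g`: it can be embedded in a closed surface, orientable or not, of
genus at most `g`. (An embedding in a surface of minimum genus is cellular.) -/
def HasGenusAtMost (G : Graph α β) (g : ℕ) : Prop :=
  ∃ M : G.CellularEmbedding, M.genus ≤ g

end Graph

end

/-! A scramble of large order points consistently to one side of every small vertex set. If `X` has
at most `K` vertices and the order exceeds `(Δ + 1) * K`, then `X` is no hitting set, so some egg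
avoids `X`. The at most `Δ * K` edges at `X` are no egg-cut, so all eggs avoiding `X` lie in one
component of `G - X`. These components form a haven (`IsScramble.isHaven`).

By the theorem of Alon, Seymour and Thomas (`IsHaven.exists_complete_model`), a haven of order about
`r ^ 2 * √n` forces a model of `K_r`. Its proof keeps a partial model whose branch sets are attached
to the haven's side of a small separator. `exists_connectedOn_or_separator`, applied to the
neighbourhoods of the branch sets, supplies either a small connected set, which becomes a new branch
set, or a small set that cuts the haven's side off from one branch set, which can then be enlarged.
A potential decreases at each step, so the model is eventually complete.

It remains to exclude models of `K_r` in each class. A model yields a minor by deletions and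
contractions.

In the plane, a model of `K_5` gives curves joining five points such that the curves of disjoint
pairs are disjoint. Comparing logarithm changes of the curves seen from the points gives a
contradiction modulo 4, in effect because the drawing of `K_5` on a convex pentagon has an odd
number of crossings.

On a surface, the face boundaries modulo 2 have codimension at most `2 - χ` in the cycle space.
Restricted to the edges chosen between branch sets, the cycle space has dimension at least `(r - 1)
* (r - 2) / 2`, from the triangles through one branch set. The face boundaries contribute at most `r
* (r - 1) / 3`, since a nonzero one uses at least three edges and each edge lies on at most two
faces. For `r = 12 * g + 8` this is inconsistent. -/

noncomputable section

/-! ### Sets that are connected with respect to a relation -/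

section ConnectedOn

variable {α : Type u} {R : α → α → Prop}

/-- Any two points of `T` are joined by an `R`-path inside `T`. -/
def ConnectedOn (R : α → α → Prop) (T : Set α) : Prop :=
  ∀ x ∈ T, ∀ y ∈ T, Relation.ReflTransGen (fun a b ↦ R a b ∧ a ∈ T ∧ b ∈ T) x y

lemma ReflTransGen.within_mono {S T : Set α} (h : S ⊆ T) {x y : α}
    (hxy : Relation.ReflTransGen (fun a b ↦ R a b ∧ a ∈ S ∧ b ∈ S) x y) :
    Relation.ReflTransGen (fun a b ↦ R a b ∧ a ∈ T ∧ b ∈ T) x y :=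
  Relation.ReflTransGen.mono (fun _ _ hab ↦ ⟨hab.1, h hab.2.1, h hab.2.2⟩) _ _ hxy

lemma ReflTransGen.within_symm (hR : ∀ a b, R a b → R b a) {T : Set α} {x y : α}
    (hxy : Relation.ReflTransGen (fun a b ↦ R a b ∧ a ∈ T ∧ b ∈ T) x y) :
    Relation.ReflTransGen (fun a b ↦ R a b ∧ a ∈ T ∧ b ∈ T) y x := by
  induction hxy with
  | refl => exact .refl
  | tail _ h ih => exact .head ⟨hR _ _ h.1, h.2.2, h.2.1⟩ ih

lemma ConnectedOn.of_hub (hR : ∀ a b, R a b → R b a) {T : Set α} (x : α)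
    (h : ∀ y ∈ T, Relation.ReflTransGen (fun a b ↦ R a b ∧ a ∈ T ∧ b ∈ T) x y) :
    ConnectedOn R T :=
  fun y hy z hz ↦ (ReflTransGen.within_symm hR (h y hy)).trans (h z hz)

lemma connectedOn_empty : ConnectedOn R (∅ : Set α) := fun _ h ↦ h.elim

lemma connectedOn_singleton (x : α) : ConnectedOn R ({x} : Set α) := by
  rintro _ rfl _ rfl
  exact .refl

lemma ConnectedOn.union (hR : ∀ a b, R a b → R b a) {S T : Set α} (hS : ConnectedOn R S)
    (hT : ConnectedOn R T) {x y : α} (hx : x ∈ S) (hy : y ∈ T) (hxy : R x y) :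
    ConnectedOn R (S ∪ T) := by
  refine .of_hub hR x ?_
  rintro z (hz | hz)
  · exact ReflTransGen.within_mono Set.subset_union_left (hS x hx z hz)
  · exact .head ⟨hxy, .inl hx, .inr hy⟩
      (ReflTransGen.within_mono Set.subset_union_right (hT y hy z hz))

lemma ConnectedOn.induction {T : Set α} (hT : ConnectedOn R T) {P : α → Prop} {x : α}
    (hx : x ∈ T) (hPx : P x) (step : ∀ a b, R a b → a ∈ T → b ∈ T → P a → P b) :
    ∀ y ∈ T, P y := by
  intro y hy
  have := hT x hx y hy
  induction this with
  | refl => exact hPx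
  | tail _ h ih => exact step _ _ h.1 h.2.1 h.2.2 (ih h.2.1)

end ConnectedOn

/-! ### Small connected sets or small separators -/

section Separator

variable {α : Type u} {R : α → α → Prop}

open Classical in
/-- Either a small connected set meets all the sets `A i`, or a small set `Z` separates them in the
sense that no connected set avoiding `Z` meets all of them. -/
theorem exists_connectedOn_or_separator (hR : ∀ a b, R a b → R b a) (H : Finset α) {r L : ℕ}
    (hL : 0 < L) (A : Fin r → Finset α) :
    (∃ T ⊆ H, T.Nonempty ∧ ConnectedOn R (T : Set α) ∧ T.card ≤ L ∧ ∀ i, ∃ x ∈ T, x ∈ A i) ∨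
    ∃ Z ⊆ H, Z.card * L ≤ (r + 1) * H.card ∧ ∀ K ⊆ H, K.Nonempty → ConnectedOn R (K : Set α) →
      Disjoint K Z → ∃ i, Disjoint K (A i) := by
  -- The least `t` with `Q i t v` acts as a distance: the size of a smallest connected set that
  -- contains `v` and meets the first `i` of the sets `A j`. `N i t` is the layer at distance
  -- exactly `t + 2`.
  let Q : ℕ → ℕ → α → Prop := fun i t v ↦ ∃ T ⊆ H, v ∈ T ∧ ConnectedOn R (T : Set α) ∧
    T.card ≤ t ∧ ∀ j : Fin r, j.1 < i → ∃ x ∈ T, x ∈ A j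
  have Qmono : ∀ i t t' v, t ≤ t' → Q i t v → Q i t' v := by
    rintro i t t' v h ⟨T, h1, h2, h3, h4, h5⟩
    exact ⟨T, h1, h2, h3, h4.trans h, h5⟩
  let N : ℕ → ℕ → Finset α := fun i t ↦ H.filter fun v ↦ Q i (t + 2) v ∧ ¬ Q i (t + 1) v
  let Z : ℕ → Finset α := fun t ↦ (Finset.range (r + 1)).biUnion fun i ↦ N i t
  have hN : ∀ i, ∑ t ∈ Finset.range L, (N i t).card ≤ H.card := by
    intro i
    rw [← Finset.card_biUnion]
    · exact Finset.card_le_card (Finset.biUnion_subset.2 fun t _ ↦ Finset.filter_subset _ _)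
    · have key : ∀ t t', t < t' → Disjoint (N i t) (N i t') := by
        intro t t' htt'
        rw [Finset.disjoint_left]
        intro v hv hv'
        simp only [N, Finset.mem_filter] at hv hv'
        exact hv'.2.2 (Qmono _ _ _ _ (by omega) hv.2.1)
      intro t _ t' _ htt'
      rcases lt_or_gt_of_ne htt' with h | h
      · exact key _ _ h
      · exact (key _ _ h).symm
  have hZ : ∑ t ∈ Finset.range L, (Z t).card ≤ (r + 1) * H.card := by
    calc ∑ t ∈ Finset.range L, (Z t).card
        ≤ ∑ t ∈ Finset.range L, ∑ i ∈ Finset.range (r + 1), (N i t).card :=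
          Finset.sum_le_sum fun t _ ↦ Finset.card_biUnion_le
      _ = ∑ i ∈ Finset.range (r + 1), ∑ t ∈ Finset.range L, (N i t).card := Finset.sum_comm
      _ ≤ ∑ i ∈ Finset.range (r + 1), H.card := Finset.sum_le_sum fun i _ ↦ hN i
      _ = (r + 1) * H.card := by simp
  -- For each `i` the layers are disjoint, so the `L` sets `Z t` have total size at most `(r + 1) *
  -- H.card`, and some `Z t` is at most the average.
  obtain ⟨t, ht, htZ⟩ : ∃ t ∈ Finset.range L, (Z t).card * L ≤ (r + 1) * H.card := by
    apply Finset.exists_le_of_sum_le (Finset.nonempty_range_iff.2 hL.ne')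
    rw [← Finset.sum_mul, Finset.sum_const, Finset.card_range, smul_eq_mul, mul_comm L]
    exact Nat.mul_le_mul_right L hZ
  rw [Finset.mem_range] at ht
  by_contra! hcon
  obtain ⟨hcon₁, hcon₂⟩ := hcon
  obtain ⟨K, hKH, ⟨x, hx⟩, hK, hKZ, hKA⟩ := hcon₂ (Z t)
    (Finset.biUnion_subset.2 fun i _ ↦ Finset.filter_subset _ _) htZ
  -- A point of `K` in `A i` passes from level `i` to level `i + 1` at no cost. The bound then
  -- spreads along `K`: a step raises it by at most one, to `t + 2`, and a point off `Z t` with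
  -- bound `t + 2` already has bound `t + 1`.
  have main : ∀ i ≤ r, ∀ v ∈ K, Q i (t + 1) v := by
    intro i
    induction i with
    | zero =>
      intro _ v hv
      exact ⟨{v}, by simpa using hKH hv, by simp, by simpa using connectedOn_singleton v,
        by simp, by simp⟩
    | succ i ih =>
      intro hi
      obtain ⟨w, hwK, hwA⟩ := Finset.not_disjoint_iff.1 (hKA ⟨i, by omega⟩)
      obtain ⟨T, h1, h2, h3, h4, h5⟩ := ih (by omega) w hwK
      refine hK.induction (P := fun v ↦ Q (i + 1) (t + 1) v) hwK ⟨T, h1, h2, h3, h4, ?_⟩ ?_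
      · intro j hj
        rcases Nat.lt_succ_iff_lt_or_eq.1 hj with hj | hj
        · exact h5 j hj
        · exact ⟨w, h2, by convert hwA⟩
      · rintro a b hab - hb ⟨T, h1, h2, h3, h4, h5⟩
        by_contra hQ
        refine Finset.disjoint_left.1 hKZ hb (Finset.mem_biUnion.2 ⟨i + 1, by simp; omega,
          Finset.mem_filter.2 ⟨hKH hb, ⟨insert b T, ?_, by simp, ?_, ?_, ?_⟩, hQ⟩⟩)
        · exact Finset.insert_subset (hKH hb) h1
        · rw [Finset.coe_insert, ← Set.singleton_union]
          exact (connectedOn_singleton b).union hR h3 rfl h2 (hR _ _ hab)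
        · exact (Finset.card_insert_le _ _).trans (by omega)
        · intro j hj
          obtain ⟨x, hx, hxA⟩ := h5 j hj
          exact ⟨x, Finset.mem_insert_of_mem hx, hxA⟩
  obtain ⟨T, h1, h2, h3, h4, h5⟩ := main r le_rfl x hx
  obtain ⟨i, hi⟩ := hcon₁ T h1 ⟨x, h2⟩ h3 (h4.trans (by omega))
  obtain ⟨y, hy, hyA⟩ := h5 i i.2
  exact hi y hy hyA

end Separator

/-! ### Havens and complete minors -/

section Haven

variable {α : Type u} {R : α → α → Prop}

/-- A haven of order `K` (on sets of at most `K` vertices). -/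
structure IsHaven (R : α → α → Prop) (K : ℕ) (V : Finset α) (b : Finset α → Finset α) : Prop where
  subset : ∀ X, X.card ≤ K → b X ⊆ V
  disjoint : ∀ X, X.card ≤ K → Disjoint (b X) X
  nonempty : ∀ X, X.card ≤ K → (b X).Nonempty
  connectedOn : ∀ X, X.card ≤ K → ConnectedOn R (b X : Set α)
  closed : ∀ X, X.card ≤ K → ∀ u ∈ b X, ∀ v, R u v → v ∉ X → v ∈ b X
  anti : ∀ X Y, X ⊆ Y → Y.card ≤ K → b Y ⊆ b X

/-- Since `b X` is connected, avoids `X` and contains the nonempty `b Y`, it cannot leave `S`. This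
controls the haven's side when the separator changes without simply growing. -/
lemma IsHaven.subset_of_closed {K : ℕ} {V : Finset α} {b : Finset α → Finset α}
    (hb : IsHaven R K V b) {X Y S : Finset α} (hXY : X ⊆ Y) (hY : Y.card ≤ K) (hS : b Y ⊆ S)
    (hclosed : ∀ u ∈ S, ∀ v, R u v → v ∉ X → v ∈ S) : b X ⊆ S := by
  have hX : X.card ≤ K := (Finset.card_le_card hXY).trans hY
  obtain ⟨x, hx⟩ := hb.nonempty Y hY
  exact (hb.connectedOn X hX).induction (P := fun v ↦ v ∈ S) (hb.anti X Y hXY hY hx) (hS hx)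
    fun a c hac _ hc ha ↦ hclosed a ha c hac (Finset.disjoint_left.1 (hb.disjoint X hX) hc)

/-- The data of a partial model of a complete graph in the complement of a haven: the `i`-th
component is a pair of a branch set (empty if not in use) and its intersection with the
separator. -/
structure IsCovey {r : ℕ} (R : α → α → Prop) (s : ℕ) (U : Finset α)
    (P : Fin r → Finset α × Finset α) : Prop where
  connectedOn : ∀ i, ConnectedOn R ((P i).1 : Set α)
  disjoint : ∀ i j, i ≠ j → Disjoint (P i).1 (P j).1
  adj : ∀ i j, i ≠ j → (P i).1.Nonempty → (P j).1.Nonempty → ∃ x ∈ (P i).1, ∃ y ∈ (P j).1, R x y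
  subset : ∀ i, (P i).2 ⊆ (P i).1
  card_le : ∀ i, (P i).2.card ≤ s
  disjoint_rest : ∀ i, Disjoint (P i).1 U

lemma IsCovey.update (hR : ∀ a b, R a b → R b a) {r s : ℕ} {U U' : Finset α}
    {P : Fin r → Finset α × Finset α} (hP : IsCovey R s U P) (hU : U' ⊆ U) (i : Fin r)
    {T Y : Finset α} (hT : ConnectedOn R (T : Set α)) (hTP : ∀ j, j ≠ i → Disjoint T (P j).1)
    (hadj : T.Nonempty → ∀ j, j ≠ i → (P j).1.Nonempty → ∃ x ∈ T, ∃ y ∈ (P j).1, R x y)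
    (hY : Y ⊆ T) (hYs : Y.card ≤ s) (hTU : Disjoint T U') :
    IsCovey R s U' (Function.update P i (T, Y)) := by
  have h : ∀ j, j ≠ i → Function.update P i (T, Y) j = P j := fun j hj ↦
    Function.update_of_ne hj _ _
  have hi : Function.update P i (T, Y) i = (T, Y) := Function.update_self _ _ _
  refine ⟨fun j ↦ ?_, fun j k hjk ↦ ?_, fun j k hjk ↦ ?_, fun j ↦ ?_, fun j ↦ ?_, fun j ↦ ?_⟩
  · rcases eq_or_ne j i with rfl | hj
    · rwa [hi]
    · rw [h j hj]; exact hP.connectedOn j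
  · rcases eq_or_ne j i with rfl | hj
    · rw [hi, h k hjk.symm]; exact hTP k hjk.symm
    · rcases eq_or_ne k i with rfl | hk
      · rw [hi, h j hj]; exact (hTP j hj).symm
      · rw [h j hj, h k hk]; exact hP.disjoint j k hjk
  · rcases eq_or_ne j i with rfl | hj
    · rw [hi, h k hjk.symm]; exact fun hT ↦ hadj hT k hjk.symm
    · rcases eq_or_ne k i with rfl | hk
      · rw [hi, h j hj]
        intro h1 h2
        obtain ⟨x, hx, y, hy, hxy⟩ := hadj h2 j hj h1
        exact ⟨y, hy, x, hx, hR _ _ hxy⟩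
      · rw [h j hj, h k hk]; exact hP.adj j k hjk
  · rcases eq_or_ne j i with rfl | hj
    · rwa [hi]
    · rw [h j hj]; exact hP.subset j
  · rcases eq_or_ne j i with rfl | hj
    · rwa [hi]
    · rw [h j hj]; exact hP.card_le j
  · rcases eq_or_ne j i with rfl | hj
    · rwa [hi]
    · rw [h j hj]; exact (hP.disjoint_rest j).mono_right hU

lemma sum_comp_update {ι γ : Type*} [Fintype ι] [DecidableEq ι] (P : ι → γ) (i : ι) (p : γ)
    (f : γ → ℕ) : ∑ j, f (Function.update P i p j) + f (P i) = ∑ j, f (P j) + f p := by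
  rw [← Finset.add_sum_erase _ _ (Finset.mem_univ i),
    ← Finset.add_sum_erase _ (fun j ↦ f (P j)) (Finset.mem_univ i),
    Finset.sum_congr rfl fun j hj ↦ by rw [Function.update_of_ne (Finset.ne_of_mem_erase hj)]]
  simp only [Function.update_self]
  omega

open Classical in
/-- The separator of a covey. -/
def coveySeparator {r : ℕ} (P : Fin r → Finset α × Finset α) : Finset α :=
  Finset.univ.biUnion fun i ↦ (P i).2

open Classical in
/-- The weight of a component of a covey. -/
def coveyWeight (p : Finset α × Finset α) : ℕ := (if p.1.Nonempty then 1 else 0) + p.2.card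

/-- The quantity that decreases when a covey is improved. -/
def coveyMeasure {r : ℕ} (b : Finset α → Finset α) (P : Fin r → Finset α × Finset α) : ℕ :=
  -- The factor 3 pays for a new branch set `T`: the weights rise by `1 + T.card`, while the haven's
  -- side loses at least `T.card ≥ 1` vertices.
  ∑ i, coveyWeight (P i) + 3 * (b (coveySeparator P)).card

lemma IsCovey.card_separator_le {r s : ℕ} {U : Finset α} {P : Fin r → Finset α × Finset α}
    (hP : IsCovey R s U P) : (coveySeparator P).card ≤ r * s := by
  classical
  refine (Finset.card_biUnion_le).trans ((Finset.sum_le_sum fun i _ ↦ hP.card_le i).trans ?_)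
  simp

open Classical in
lemma coveySeparator_update_subset {r : ℕ} (P : Fin r → Finset α × Finset α) (i : Fin r)
    (p : Finset α × Finset α) :
    coveySeparator (Function.update P i p) ⊆ coveySeparator P ∪ p.2 := by
  intro x hx
  simp only [coveySeparator, Finset.mem_biUnion, Finset.mem_univ, true_and, Finset.mem_union] at *
  obtain ⟨j, hj⟩ := hx
  rcases eq_or_ne j i with rfl | h
  · rw [Function.update_self] at hj; exact .inr hj
  · rw [Function.update_of_ne h] at hj; exact .inl ⟨j, hj⟩

lemma mem_coveySeparator {r : ℕ} {P : Fin r → Finset α × Finset α} {x : α} :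
    x ∈ coveySeparator P ↔ ∃ i, x ∈ (P i).2 := by
  simp [coveySeparator]

lemma mem_coveySeparator_update {r : ℕ} {P : Fin r → Finset α × Finset α} {i : Fin r}
    {p : Finset α × Finset α} {x : α} : x ∈ coveySeparator (Function.update P i p) ↔
      x ∈ p.2 ∨ ∃ j, j ≠ i ∧ x ∈ (P j).2 := by
  rw [mem_coveySeparator]
  constructor
  · rintro ⟨j, hj⟩
    rcases eq_or_ne j i with rfl | h
    · rw [Function.update_self] at hj; exact .inl hj
    · rw [Function.update_of_ne h] at hj; exact .inr ⟨j, h, hj⟩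
  · rintro (h | ⟨j, hji, hj⟩)
    · exact ⟨i, by rwa [Function.update_self]⟩
    · exact ⟨j, by rwa [Function.update_of_ne hji]⟩

end Haven

/-! ### The three ways of improving a covey, and the Alon–Seymour–Thomas theorem -/

section Haven

variable {α : Type u} {R : α → α → Prop}

open Classical in
/-- Drop a branch set that has no neighbour in the rest. -/
lemma IsCovey.exists_lt_of_no_neighbour (hR : ∀ a b, R a b → R b a) {r s K : ℕ} (hK : r * s ≤ K)
    {V : Finset α} {b : Finset α → Finset α} (hb : IsHaven R K V b)
    {P : Fin r → Finset α × Finset α} (hP : IsCovey R s (b (coveySeparator P)) P) (i : Fin r)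
    (hi : (P i).1.Nonempty)
    (hA : ∀ u ∈ b (coveySeparator P), ∀ c ∈ (P i).1, ¬ R c u) :
    ∃ P' : Fin r → Finset α × Finset α, IsCovey R s (b (coveySeparator P')) P' ∧
      coveyMeasure b P' < coveyMeasure b P := by
  set X := coveySeparator P with hX
  set P' := Function.update P i (∅, ∅) with hP'
  have hXK : X.card ≤ K := hP.card_separator_le.trans hK
  have hsub : coveySeparator P' ⊆ X := by
    simpa using coveySeparator_update_subset P i (∅, ∅)
  have hbsub : b (coveySeparator P') ⊆ b X := by
    -- Removing separator vertices that have no neighbour in `b X` opens no way out of `b X`.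
    refine hb.subset_of_closed hsub hXK subset_rfl fun u hu v huv hv ↦ hb.closed X hXK u hu v huv ?_
    intro hvX
    obtain ⟨j, hj⟩ := mem_coveySeparator.1 hvX
    rcases eq_or_ne j i with rfl | hji
    · exact hA u hu v (hP.subset j hj) (hR _ _ huv)
    · exact hv (mem_coveySeparator_update.2 (.inr ⟨j, hji, hj⟩))
  refine ⟨P', hP.update hR hbsub i (by simpa using connectedOn_empty) (by simp) (by simp) (by simp)
    (by simp) (by simp), ?_⟩
  have h1 := sum_comp_update P i (∅, ∅) coveyWeight
  have h2 := Finset.card_le_card hbsub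
  have h3 : 0 < coveyWeight (P i) := by simp [coveyWeight, hi]
  have h4 : coveyWeight ((∅, ∅) : Finset α × Finset α) = 0 := by simp [coveyWeight]
  simp only [coveyMeasure, ← hX]
  rw [← hP', h4] at h1
  omega

open Classical in
/-- Add a small connected set that meets the neighbourhoods of all branch sets. -/
lemma IsCovey.exists_lt_of_connectedOn (hR : ∀ a b, R a b → R b a) {r s K : ℕ}
    (hK : r * s + s ≤ K) {V : Finset α} {b : Finset α → Finset α} (hb : IsHaven R K V b)
    {P : Fin r → Finset α × Finset α} (hP : IsCovey R s (b (coveySeparator P)) P) (i : Fin r)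
    (hi : ¬ (P i).1.Nonempty) {T : Finset α} (hT : T ⊆ b (coveySeparator P)) (hTne : T.Nonempty)
    (hTconn : ConnectedOn R (T : Set α)) (hTs : T.card ≤ s)
    (hTA : ∀ j, (P j).1.Nonempty → ∃ x ∈ T, ∃ c ∈ (P j).1, R c x) :
    ∃ P' : Fin r → Finset α × Finset α, IsCovey R s (b (coveySeparator P')) P' ∧
      coveyMeasure b P' < coveyMeasure b P := by
  set X := coveySeparator P with hX
  -- All of `T` joins the separator, so the new haven's side avoids it and shrinks by at least
  -- `T.card`.
  set P' := Function.update P i (T, T) with hP'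
  have hi1 : (P i).1 = ∅ := Finset.not_nonempty_iff_eq_empty.1 hi
  have hi2 : (P i).2 = ∅ := Finset.subset_empty.1 (hi1 ▸ hP.subset i)
  have hX' : X ⊆ coveySeparator P' := by
    intro x hx
    obtain ⟨j, hj⟩ := mem_coveySeparator.1 hx
    refine mem_coveySeparator_update.2 (.inr ⟨j, ?_, hj⟩)
    rintro rfl
    simp [hi2] at hj
  have hTX' : T ⊆ coveySeparator P' := fun x hx ↦ mem_coveySeparator_update.2 (.inl hx)
  have hX'K : (coveySeparator P').card ≤ K := by
    refine (Finset.card_le_card (coveySeparator_update_subset P i (T, T))).trans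
      ((Finset.card_union_le _ _).trans ?_)
    have := hP.card_separator_le
    simp only
    omega
  have hbsub := hb.anti _ _ hX' hX'K
  have hdisj : Disjoint T (b (coveySeparator P')) :=
    ((hb.disjoint _ hX'K).mono_right hTX').symm
  refine ⟨P', hP.update hR hbsub i hTconn (fun j _ ↦ ((hP.disjoint_rest j).mono_right hT).symm)
    ?_ subset_rfl hTs hdisj, ?_⟩
  · intro _ j _ hj
    obtain ⟨x, hx, c, hc, hcx⟩ := hTA j hj
    exact ⟨x, hx, c, hc, hR _ _ hcx⟩
  have h1 := sum_comp_update P i (T, T) coveyWeight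
  have h2 : (T ∪ b (coveySeparator P')).card ≤ (b X).card :=
    Finset.card_le_card (Finset.union_subset hT hbsub)
  rw [Finset.card_union_of_disjoint hdisj] at h2
  have h3 : coveyWeight (T, T) = 1 + T.card := by simp [coveyWeight, hTne]
  have h5 := hTne.card_pos
  simp only [coveyMeasure, ← hX]
  rw [← hP', h3] at h1
  omega

open Classical in
/-- Enlarge a branch set that does not reach the far side of a small separator. -/
lemma IsCovey.exists_lt_of_separator (hR : ∀ a b, R a b → R b a) {r s K : ℕ}
    (hK : r * s + s ≤ K) {V : Finset α} {b : Finset α → Finset α} (hb : IsHaven R K V b)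
    {P : Fin r → Finset α × Finset α} (hP : IsCovey R s (b (coveySeparator P)) P) (i : Fin r)
    {Z : Finset α} (hZs : Z.card ≤ s)
    (hA : ∃ u ∈ b (coveySeparator P), ∃ c ∈ (P i).1, R c u)
    (hD : ∀ u ∈ b (coveySeparator P ∪ Z), ∀ c ∈ (P i).1, ¬ R c u) :
    ∃ P' : Fin r → Finset α × Finset α, IsCovey R s (b (coveySeparator P')) P' ∧
      coveyMeasure b P' < coveyMeasure b P := by
  set X := coveySeparator P with hX
  have hXK : X.card ≤ r * s := hP.card_separator_le
  have hXZ : (X ∪ Z).card ≤ K := (Finset.card_union_le _ _).trans (by omega)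
  set D := b (X ∪ Z) with hDdef
  have hDX : D ⊆ b X := hb.anti _ _ Finset.subset_union_left hXZ
  let F : Set α := {x | x ∈ b X ∧ x ∉ D}
  -- `W` is everything in `b X` outside `D` that the branch set can reach without entering `D`.
  -- Absorbing `W`, the branch set needs only the boundary `Y` of `W` towards `D` in the separator,
  -- and `Y` lies in `Z` because `D` is closed off `X ∪ Z`.
  let W : Finset α := (b X).filter fun w ↦ ∃ a ∈ b X, a ∉ D ∧ (∃ c ∈ (P i).1, R c a) ∧
    Relation.ReflTransGen (fun x y ↦ R x y ∧ x ∈ F ∧ y ∈ F) a w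
  have hWF : ∀ w ∈ W, w ∈ F := by
    intro w hw
    obtain ⟨hw, a, ha, haD, -, h⟩ := Finset.mem_filter.1 hw
    rcases Relation.ReflTransGen.cases_tail h with rfl | ⟨c, -, h⟩
    · exact ⟨ha, haD⟩
    · exact h.2.2
  have hWb : W ⊆ b X := Finset.filter_subset _ _
  let Y : Finset α := W.filter fun w ↦ ∃ d ∈ D, R d w
  have hYW : Y ⊆ W := Finset.filter_subset _ _
  have hYZ : Y ⊆ Z := by
    intro w hw
    obtain ⟨hw, d, hd, hdw⟩ := Finset.mem_filter.1 hw
    by_contra hwZ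
    refine (hWF w hw).2 (hb.closed _ hXZ d hd w hdw ?_)
    rw [Finset.mem_union, not_or]
    exact ⟨Finset.disjoint_left.1 (hb.disjoint X (by omega)) (hWb hw), hwZ⟩
  set T := (P i).1 ∪ W with hT
  set P' := Function.update P i (T, Y) with hP'
  have hnbr : ∀ a ∈ b X, a ∉ D → (∃ c ∈ (P i).1, R c a) → a ∈ W := fun a ha haD hc ↦
    Finset.mem_filter.2 ⟨ha, a, ha, haD, hc, .refl⟩
  have hX' : coveySeparator P' ⊆ X ∪ Z :=
    (coveySeparator_update_subset P i (T, Y)).trans (Finset.union_subset_union subset_rfl hYZ)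
  -- The set `b X \ W` contains `D` and can be left only through the new separator: steps into `W`
  -- start in `D` and end in `Y`, and the old part `(P i).2` has neighbours neither in `D` nor in `b
  -- X \ W`.
  have hbsub : b (coveySeparator P') ⊆ b X \ W := by
    refine hb.subset_of_closed hX' hXZ ?_ ?_
    · intro x hx
      exact Finset.mem_sdiff.2 ⟨hDX hx, fun h ↦ (hWF x h).2 hx⟩
    · intro u hu v huv hv
      rw [Finset.mem_sdiff] at hu ⊢
      have hvb : v ∈ b X := by
        refine hb.closed X (by omega) u hu.1 v huv fun hvX ↦ ?_
        obtain ⟨j, hj⟩ := mem_coveySeparator.1 hvX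
        rcases eq_or_ne j i with rfl | hji
        · have hvu := hR _ _ huv
          by_cases huD : u ∈ D
          · exact hD u huD v (hP.subset j hj) hvu
          · exact hu.2 (hnbr u hu.1 huD ⟨v, hP.subset j hj, hvu⟩)
        · exact hv (mem_coveySeparator_update.2 (.inr ⟨j, hji, hj⟩))
      refine ⟨hvb, fun hvW ↦ ?_⟩
      by_cases huD : u ∈ D
      · exact hv (mem_coveySeparator_update.2 (.inl (Finset.mem_filter.2 ⟨hvW, u, huD, huv⟩)))
      · obtain ⟨-, a, ha, haD, hc, h⟩ := Finset.mem_filter.1 hvW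
        exact hu.2 (Finset.mem_filter.2 ⟨hu.1, a, ha, haD, hc,
          h.tail ⟨hR _ _ huv, hWF v hvW, hu.1, huD⟩⟩)
  have hbsub' : b (coveySeparator P') ⊆ b X := hbsub.trans Finset.sdiff_subset
  obtain ⟨a₀, ha₀, c₀, hc₀, hca₀⟩ := hA
  have ha₀W : a₀ ∈ W := hnbr a₀ ha₀ (fun h ↦ hD a₀ h c₀ hc₀ hca₀) ⟨c₀, hc₀, hca₀⟩
  have hTconn : ConnectedOn R (T : Set α) := by
    refine .of_hub hR c₀ fun y hy ↦ ?_
    have hPT : ((P i).1 : Set α) ⊆ T := by simp [hT]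
    have hcT : ∀ c ∈ (P i).1, Relation.ReflTransGen
        (fun x y ↦ R x y ∧ x ∈ (T : Set α) ∧ y ∈ (T : Set α)) c₀ c :=
      fun c hc ↦ ReflTransGen.within_mono hPT (hP.connectedOn i c₀ hc₀ c hc)
    rcases Finset.mem_union.1 (Finset.mem_coe.1 hy) with hy | hy
    · exact hcT y hy
    · obtain ⟨-, a, ha, haD, ⟨c, hc, hca⟩, h⟩ := Finset.mem_filter.1 hy
      have haW := hnbr a ha haD ⟨c, hc, hca⟩
      have hWT : ∀ w ∈ W, w ∈ (T : Set α) := fun w hw ↦ by simp [hT, hw]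
      refine (hcT c hc).trans (.head ⟨hca, hPT hc, hWT a haW⟩ ?_)
      have : ∀ z, Relation.ReflTransGen (fun x y ↦ R x y ∧ x ∈ F ∧ y ∈ F) a z → z ∈ W ∧
          Relation.ReflTransGen (fun x y ↦ R x y ∧ x ∈ (T : Set α) ∧ y ∈ (T : Set α)) a z := by
        intro z hz
        induction hz with
        | refl => exact ⟨haW, .refl⟩
        | @tail y z haz hzz ih =>
          have : z ∈ W := Finset.mem_filter.2 ⟨hzz.2.2.1, a, ha, haD, ⟨c, hc, hca⟩, haz.tail hzz⟩
          exact ⟨this, ih.2.tail ⟨hzz.1, hWT _ ih.1, hWT _ this⟩⟩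
      exact (this y h).2
  refine ⟨P', hP.update hR hbsub' i hTconn ?_ ?_ (hYW.trans Finset.subset_union_right)
    ((Finset.card_le_card hYZ).trans hZs) ?_, ?_⟩
  · intro j hj
    rw [hT, Finset.disjoint_union_left]
    exact ⟨hP.disjoint i j hj.symm, ((hP.disjoint_rest j).mono_right hWb).symm⟩
  · intro _ j hj hjne
    obtain ⟨x, hx, y, hy, hxy⟩ := hP.adj i j hj.symm ⟨c₀, hc₀⟩ hjne
    exact ⟨x, Finset.mem_union_left _ hx, y, hy, hxy⟩
  · rw [hT, Finset.disjoint_union_left]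
    exact ⟨(hP.disjoint_rest i).mono_right hbsub', Finset.disjoint_sdiff.mono_right hbsub⟩
  have h1 := sum_comp_update P i (T, Y) coveyWeight
  have h2 := Finset.card_le_card hbsub
  rw [Finset.card_sdiff_of_subset hWb] at h2
  have h3 := Finset.card_le_card hWb
  have h4 := Finset.card_le_card hYW
  have h5 : 0 < W.card := Finset.card_pos.2 ⟨a₀, ha₀W⟩
  have h6 : coveyWeight (T, Y) = 1 + Y.card := by
    simp [coveyWeight, hT, show ((P i).1 ∪ W).Nonempty from ⟨a₀, Finset.mem_union_right _ ha₀W⟩]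
  have h7 : 1 ≤ coveyWeight (P i) := by
    simp [coveyWeight, show (P i).1.Nonempty from ⟨c₀, hc₀⟩]
  simp only [coveyMeasure, ← hX]
  rw [← hP', h6] at h1
  omega

open Classical in
/-- Alon, Seymour and Thomas: a haven of large order forces a complete minor. -/
theorem IsHaven.exists_complete_model (hR : ∀ a b, R a b → R b a) {r L K : ℕ} (hL : 0 < L)
    {V : Finset α} (hV : V.card ≤ L * L) (hK : r * ((r + 1) * L) + (r + 1) * L ≤ K)
    {b : Finset α → Finset α} (hb : IsHaven R K V b) :
    ∃ B : Fin r → Finset α, (∀ i, (B i).Nonempty) ∧ (∀ i, ConnectedOn R (B i : Set α)) ∧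
      (∀ i j, i ≠ j → Disjoint (B i) (B j)) ∧
      ∀ i j, i ≠ j → ∃ x ∈ B i, ∃ y ∈ B j, R x y := by
  -- `s` bounds the separators obtained from `V.card ≤ L * L`. The order `K` leaves room for `r`
  -- parts of size `s` and one further set of that size.
  set s := (r + 1) * L with hs
  have main : ∀ m, ∀ P : Fin r → Finset α × Finset α, IsCovey R s (b (coveySeparator P)) P →
      coveyMeasure b P = m → ∃ P' : Fin r → Finset α × Finset α,
        IsCovey R s (b (coveySeparator P')) P' ∧ ∀ i, (P' i).1.Nonempty := by
    intro m
    induction m using Nat.strong_induction_on with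
    | _ m ih =>
      intro P hP hm
      by_cases hall : ∀ i, (P i).1.Nonempty
      · exact ⟨P, hP, hall⟩
      suffices ∃ P' : Fin r → Finset α × Finset α, IsCovey R s (b (coveySeparator P')) P' ∧
          coveyMeasure b P' < coveyMeasure b P by
        obtain ⟨P', hP', hlt⟩ := this
        exact ih _ (hm ▸ hlt) P' hP' rfl
      push Not at hall
      obtain ⟨i₀, hi₀⟩ := hall
      have hXK : (coveySeparator P).card ≤ r * s := hP.card_separator_le
      by_cases hA : ∃ i, (P i).1.Nonempty ∧
          ∀ u ∈ b (coveySeparator P), ∀ c ∈ (P i).1, ¬ R c u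
      · obtain ⟨i, hi, hA⟩ := hA
        exact hP.exists_lt_of_no_neighbour hR (by omega) hb i hi hA
      push Not at hA
      -- For an unused branch set, `A i` is the whole haven's side. It imposes no condition on `T`,
      -- and a nonempty set inside that side cannot be disjoint from it, so the index found in the
      -- separator case is in use.
      let A : Fin r → Finset α := fun i ↦ (b (coveySeparator P)).filter fun u ↦
        (P i).1.Nonempty → ∃ c ∈ (P i).1, R c u
      rcases exists_connectedOn_or_separator hR (b (coveySeparator P)) hL A with
        ⟨T, hTb, hTne, hT, hTL, hTA⟩ | ⟨Z, hZb, hZ, hsep⟩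
      · refine hP.exists_lt_of_connectedOn hR hK hb i₀ (by simp [hi₀]) hTb hTne hT ?_ ?_
        · refine hTL.trans ?_
          rw [hs]
          exact Nat.le_mul_of_pos_left _ (by omega)
        · intro j hj
          obtain ⟨x, hx, hxA⟩ := hTA j
          exact ⟨x, hx, (Finset.mem_filter.1 hxA).2 hj⟩
      · have hZs : Z.card ≤ s := by
          refine Nat.le_of_mul_le_mul_right ?_ hL
          calc Z.card * L ≤ (r + 1) * (b (coveySeparator P)).card := hZ
            _ ≤ (r + 1) * (L * L) := Nat.mul_le_mul_left _
                ((Finset.card_le_card (hb.subset _ (by omega))).trans hV)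
            _ = s * L := by rw [hs, mul_assoc]
        have hXZ : (coveySeparator P ∪ Z).card ≤ K :=
          (Finset.card_union_le _ _).trans (by omega)
        have hDb := hb.anti _ _ (Finset.subset_union_left (s₁ := coveySeparator P) (s₂ := Z)) hXZ
        obtain ⟨i, hi⟩ := hsep (b (coveySeparator P ∪ Z)) hDb (hb.nonempty _ hXZ)
          (hb.connectedOn _ hXZ) ((hb.disjoint _ hXZ).mono_right Finset.subset_union_right)
        have hi' : ∀ u ∈ b (coveySeparator P ∪ Z), (P i).1.Nonempty ∧ ∀ c ∈ (P i).1, ¬ R c u := by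
          intro u hu
          have := Finset.disjoint_left.1 hi hu
          simp only [A, Finset.mem_filter, not_and, hDb hu, true_implies, Classical.not_imp] at this
          push Not at this
          exact this
        obtain ⟨u, hu⟩ := hb.nonempty _ hXZ
        exact hP.exists_lt_of_separator hR hK hb i hZs (hA i (hi' u hu).1)
          fun u hu ↦ (hi' u hu).2
  have h0 : IsCovey R s (b (coveySeparator fun _ : Fin r ↦ ((∅, ∅) : Finset α × Finset α)))
      (fun _ : Fin r ↦ ((∅, ∅) : Finset α × Finset α)) :=
    ⟨fun i ↦ by simpa using connectedOn_empty, by simp, by simp, by simp, by simp, by simp⟩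
  obtain ⟨P, hP, hne⟩ := main _ _ h0 rfl
  exact ⟨fun i ↦ (P i).1, hne, hP.connectedOn, hP.disjoint, fun i j hij ↦
    hP.adj i j hij (hne i) (hne j)⟩

end Haven

/-! ### From scrambles to havens, and the bound on the scramble number -/

namespace Graph

variable {α : Type u} {β : Type v} {G : Graph α β}

/-- A model of `K_r` in `G`: disjoint connected branch sets, any two of them joined by an edge. -/
def HasCompleteModel (G : Graph α β) (r : ℕ) : Prop :=
  ∃ B : Fin r → Set α, (∀ i, B i ⊆ V(G)) ∧ (∀ i, (B i).Nonempty) ∧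
    (∀ i, ConnectedOn G.Adj (B i)) ∧ (∀ i j, i ≠ j → Disjoint (B i) (B j)) ∧
    ∀ i j, i ≠ j → ∃ x ∈ B i, ∃ y ∈ B j, G.Adj x y

lemma adj_symm' (a b : α) (h : G.Adj a b) : G.Adj b a := h.symm

/-- The model found in a haven does not record that its branch sets lie in `V(G)`. An edge to
another branch set ensures this; taking `r + 2` branch sets provides one even for `r ≤ 1`. -/
lemma hasCompleteModel_of_isHaven {r L K : ℕ} (hL : 0 < L) {V : Finset α} (hV : V.card ≤ L * L)
    (hK : (r + 2) * ((r + 3) * L) + (r + 3) * L ≤ K) {b : Finset α → Finset α}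
    (hb : IsHaven G.Adj K V b) : G.HasCompleteModel r := by
  obtain ⟨B, h1, h2, h3, h4⟩ := hb.exists_complete_model adj_symm' (r := r + 2) hL hV hK
  have hne : ∀ i : Fin (r + 2), ∃ j, i ≠ j := fun i ↦ ⟨i + 1, by simp⟩
  refine ⟨fun i ↦ B (Fin.castLE (by omega) i), fun i ↦ ?_, fun i ↦ h1 _, fun i ↦ h2 _,
    fun i j hij ↦ ?_, fun i j hij ↦ ?_⟩
  · obtain ⟨j, hj⟩ := hne (Fin.castLE (by omega) i)
    obtain ⟨x, hx, y, hy, hxy⟩ := h4 _ _ hj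
    exact (h2 _).induction (P := fun v ↦ v ∈ V(G)) hx hxy.left_mem
      fun a c hac _ _ _ ↦ hac.right_mem
  · exact Finset.disjoint_coe.2 (h3 _ _ fun h ↦ hij (Fin.castLE_injective _ h))
  · exact h4 _ _ fun h ↦ hij (Fin.castLE_injective _ h)

lemma encard_incident_le {Δ : ℕ} (hΔ : ∀ x ∈ V(G), G.degree x ≤ Δ) (X : Finset α) :
    (⋃ x ∈ X, G.incidenceSet x).encard ≤ (X.card * Δ : ℕ) := by
  classical
  induction X using Finset.induction_on with
  | empty => simp
  | insert x X hx ih =>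
    rw [Finset.set_biUnion_insert, Finset.card_insert_of_notMem hx, add_mul, one_mul, add_comm,
      Nat.cast_add]
    refine (Set.encard_union_le _ _).trans (add_le_add ?_ ih)
    by_cases hxG : x ∈ V(G)
    · exact hΔ x hxG
    · have : G.incidenceSet x = ∅ := by
        ext e
        simp only [mem_incidenceSet, Set.mem_empty_iff_false, iff_false]
        exact fun h ↦ hxG h.vertex_mem
      simp [this]

lemma le_deleteEdges_incident {H : Graph α β} (hH : H ≤ G) {X : Finset α}
    (hX : Disjoint V(H) (X : Set α)) : H ≤ G.deleteEdges (⋃ x ∈ X, G.incidenceSet x) := by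
  refine ⟨by simpa using hH.vertexSet_mono, fun e x y hxy ↦ ?_⟩
  rw [deleteEdges_isLink]
  refine ⟨hxy.mono hH, fun he ↦ ?_⟩
  simp only [Set.mem_iUnion, mem_incidenceSet] at he
  obtain ⟨z, hz, hez⟩ := he
  rcases hez.eq_or_eq_of_isLink (hxy.mono hH) with rfl | rfl
  · exact Set.disjoint_left.1 hX hxy.left_mem hz
  · exact Set.disjoint_left.1 hX hxy.right_mem hz

lemma reaches_deleteEdges_incident {X : Finset α} {x y : α}
    (h : (G.deleteEdges (⋃ x ∈ X, G.incidenceSet x)).Reaches x y) :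
    Relation.ReflTransGen (fun a b ↦ G.Adj a b ∧ a ∈ (X : Set α)ᶜ ∧ b ∈ (X : Set α)ᶜ) x y := by
  refine Relation.ReflTransGen.mono ?_ _ _ h
  rintro a c ⟨e, he⟩
  rw [deleteEdges_isLink] at he
  have : ∀ z ∈ X, ¬ G.Inc e z := fun z hz hez ↦ he.2 (Set.mem_biUnion hz hez)
  exact ⟨he.1.adj, fun ha ↦ this a ha he.1.inc_left, fun hc ↦ this c hc he.1.inc_right⟩

open Classical in
/-- The side of a vertex set `X` in which a scramble lives. -/
def scrambleSide (V : Finset α) (G : Graph α β) (S : Set (Graph α β)) (X : Finset α) : Finset α :=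
  V.filter fun v ↦ ∃ H ∈ S, Disjoint V(H) (X : Set α) ∧ ∃ x ∈ V(H),
    Relation.ReflTransGen (fun a b ↦ G.Adj a b ∧ a ∈ (X : Set α)ᶜ ∧ b ∈ (X : Set α)ᶜ) x v

/-- A scramble of large order in a graph of bounded degree gives rise to a haven. -/
lemma IsScramble.isHaven {S : Set (Graph α β)} (hS : G.IsScramble S) {Δ K : ℕ}
    (hΔ : ∀ x ∈ V(G), G.degree x ≤ Δ) {V : Finset α} (hV : (V : Set α) = V(G))
    (hord : (((Δ + 1) * K : ℕ) : ℕ∞) < G.scrambleOrder S) :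
    IsHaven G.Adj K V (G.scrambleSide V S) := by
  classical
  -- The order exceeds `(Δ + 1) * K`, which is at least `K`, the bound on `X`, and at least `K * Δ`,
  -- the bound on the number of edges at `X`.
  obtain ⟨hhit, hcut⟩ := lt_min_iff.1 hord
  have hmemV : ∀ x, x ∈ V ↔ x ∈ V(G) := fun x ↦ by rw [← hV]; simp
  have hegg : ∀ X : Finset α, X.card ≤ K → ∃ H ∈ S, Disjoint V(H) (X : Set α) := by
    intro X hX
    by_contra! hcon
    have hX' : ((X ∩ V : Finset α) : Set α) ⊆ V(G) ∧
        ∀ H ∈ S, (V(H) ∩ ((X ∩ V : Finset α) : Set α)).Nonempty := by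
      refine ⟨by simp [← hV], fun H hH ↦ ?_⟩
      obtain ⟨z, hz, hzX⟩ := Set.not_disjoint_iff.1 (hcon H hH)
      exact ⟨z, hz, by simpa [hmemV] using ⟨hzX, (hS.2 H hH).1.vertexSet_mono hz⟩⟩
    refine hhit.not_ge ((biInf_le (fun X : Set α ↦ X.encard) hX').trans ?_)
    · rw [Set.encard_coe_eq_coe_finsetCard]
      norm_cast
      calc (X ∩ V).card ≤ X.card := Finset.card_le_card Finset.inter_subset_left
        _ ≤ K := hX
        _ ≤ (Δ + 1) * K := Nat.le_mul_of_pos_left _ (by omega)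
  have hjoin : ∀ X : Finset α, X.card ≤ K → ∀ H₁ ∈ S, ∀ H₂ ∈ S, Disjoint V(H₁) (X : Set α) →
      Disjoint V(H₂) (X : Set α) → ∀ x ∈ V(H₁), ∀ y ∈ V(H₂), Relation.ReflTransGen
        (fun a b ↦ G.Adj a b ∧ a ∈ (X : Set α)ᶜ ∧ b ∈ (X : Set α)ᶜ) x y := by
    intro X hX H₁ hH₁ H₂ hH₂ hd₁ hd₂ x hx y hy
    have hwithin : ∀ H ∈ S, Disjoint V(H) (X : Set α) → ∀ x ∈ V(H), ∀ y ∈ V(H),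
        Relation.ReflTransGen (fun a b ↦ G.Adj a b ∧ a ∈ (X : Set α)ᶜ ∧ b ∈ (X : Set α)ᶜ) x y := by
      intro H hH hd x hx y hy
      refine Relation.ReflTransGen.mono ?_ _ _ ((hS.2 H hH).2.2 x hx y hy)
      exact fun a c hac ↦ ⟨hac.mono (hS.2 H hH).1, Set.disjoint_left.1 hd hac.left_mem,
        Set.disjoint_left.1 hd hac.right_mem⟩
    have hnot : ¬ G.IsEggCut S (⋃ x ∈ X, G.incidenceSet x) := by
      intro hA
      refine hcut.not_ge ((biInf_le (fun A : Set β ↦ A.encard) hA).trans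
        ((encard_incident_le hΔ X).trans ?_))
      norm_cast
      calc X.card * Δ ≤ K * (Δ + 1) := Nat.mul_le_mul hX (by omega)
        _ = (Δ + 1) * K := mul_comm _ _
    have : ∃ x ∈ V(H₁), ∃ y ∈ V(H₂),
        (G.deleteEdges (⋃ x ∈ X, G.incidenceSet x)).Reaches x y := by
      by_contra! hcon
      exact hnot ⟨Set.iUnion₂_subset fun x _ ↦ G.incidenceSet_subset_edgeSet x, H₁, hH₁, H₂, hH₂,
        le_deleteEdges_incident (hS.2 H₁ hH₁).1 hd₁, le_deleteEdges_incident (hS.2 H₂ hH₂).1 hd₂,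
        hcon⟩
    obtain ⟨x', hx', y', hy', hxy'⟩ := this
    exact ((hwithin H₁ hH₁ hd₁ x hx x' hx').trans (reaches_deleteEdges_incident hxy')).trans
      (hwithin H₂ hH₂ hd₂ y' hy' y hy)
  have hclosed : ∀ X : Finset α, ∀ u ∈ G.scrambleSide V S X, ∀ v, G.Adj u v → u ∉ X → v ∉ X →
      v ∈ G.scrambleSide V S X := by
    intro X u hu v huv huX hvX
    obtain ⟨-, H, hH, hd, x, hx, h⟩ := Finset.mem_filter.1 hu
    exact Finset.mem_filter.2 ⟨(hmemV v).2 huv.right_mem, H, hH, hd, x, hx,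
      h.tail ⟨huv, by simpa using huX, by simpa using hvX⟩⟩
  have hdisj : ∀ X : Finset α, Disjoint (G.scrambleSide V S X) X := by
    intro X
    rw [Finset.disjoint_left]
    intro v hv
    obtain ⟨-, H, hH, hd, x, hx, h⟩ := Finset.mem_filter.1 hv
    rcases Relation.ReflTransGen.cases_tail h with rfl | ⟨c, -, h⟩
    · exact Set.disjoint_left.1 hd hx
    · exact h.2.2
  refine ⟨fun X _ ↦ Finset.filter_subset _ _, fun X _ ↦ hdisj X, fun X hX ↦ ?_, fun X hX ↦ ?_,
    fun X _ u hu v huv hv ↦ hclosed X u hu v huv (Finset.disjoint_left.1 (hdisj X) hu) hv,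
    fun X Y hXY _ v hv ↦ ?_⟩
  · obtain ⟨H, hH, hd⟩ := hegg X hX
    obtain ⟨x, hx⟩ := (hS.2 H hH).2.1
    exact ⟨x, Finset.mem_filter.2 ⟨(hmemV x).2 ((hS.2 H hH).1.vertexSet_mono hx),
      H, hH, hd, x, hx, .refl⟩⟩
  · intro u hu v hv
    -- A walk that avoids `X` and starts in the side of `X` stays there, so joining two points
    -- outside `X` joins them within the side.
    have key : ∀ w, Relation.ReflTransGen (fun a b ↦ G.Adj a b ∧ a ∈ (X : Set α)ᶜ ∧
        b ∈ (X : Set α)ᶜ) u w → w ∈ G.scrambleSide V S X ∧ Relation.ReflTransGen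
        (fun a b ↦ G.Adj a b ∧ a ∈ (G.scrambleSide V S X : Set α) ∧
          b ∈ (G.scrambleSide V S X : Set α)) u w := by
      intro w hw
      induction hw with
      | refl => exact ⟨hu, .refl⟩
      | tail _ h ih =>
        have := hclosed X _ ih.1 _ h.1 h.2.1 h.2.2
        exact ⟨this, ih.2.tail ⟨h.1, ih.1, this⟩⟩
    obtain ⟨-, H₁, hH₁, hd₁, x₁, hx₁, h₁⟩ := Finset.mem_filter.1 hu
    obtain ⟨-, H₂, hH₂, hd₂, x₂, hx₂, h₂⟩ := Finset.mem_filter.1 hv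
    exact (key v (((ReflTransGen.within_symm adj_symm' h₁).trans
      (hjoin X hX H₁ hH₁ H₂ hH₂ hd₁ hd₂ x₁ hx₁ x₂ hx₂)).trans h₂)).2
  · obtain ⟨hvV, H, hH, hd, x, hx, h⟩ := Finset.mem_filter.1 hv
    have hXY' : (X : Set α) ⊆ Y := Finset.coe_subset.2 hXY
    exact Finset.mem_filter.2 ⟨hvV, H, hH, hd.mono_right hXY', x, hx,
      ReflTransGen.within_mono (Set.compl_subset_compl.2 hXY') h⟩

/-- The bound on the scramble number of graphs of bounded degree without a `K_r` model. -/
theorem scrambleNumber_le_of_not_hasCompleteModel (r Δ : ℕ) : ∃ C : ℝ,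
    ∀ (α : Type u) (β : Type v) (G : Graph α β), G.IsFiniteMultigraph → ¬ G.HasCompleteModel r →
      (∀ x ∈ V(G), G.degree x ≤ Δ) →
      ∃ k : ℕ, G.scrambleNumber = k ∧ (k : ℝ) ≤ C * √(V(G).ncard : ℝ) := by
  refine ⟨(Δ + 1) * ((r + 3) * (r + 3)) * 2, fun α β G hG hr hΔ ↦ ?_⟩
  -- With `L = ⌊√n⌋ + 1` one has `n ≤ L * L`, and `L ≤ 2 * √n` because `n ≥ 1`; the latter gives the
  -- factor 2 in the constant.
  set V := hG.finite_vertexSet.toFinset with hVdef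
  have hV : (V : Set α) = V(G) := by simp [hVdef]
  have hn : V.card = V(G).ncard := (Set.ncard_eq_toFinset_card _ _).symm
  set n := V(G).ncard with hndef
  set L := Nat.sqrt n + 1 with hL
  set K := (r + 3) * (r + 3) * L with hK
  have hle : G.scrambleNumber ≤ ((Δ + 1) * K : ℕ) := by
    refine iSup₂_le fun S hS ↦ ?_
    by_contra! hlt
    refine hr (hasCompleteModel_of_isHaven (L := L) (K := K) (by omega) (V := V) ?_ ?_
      (IsScramble.isHaven hS hΔ hV hlt))
    · rw [hn]; exact (Nat.lt_succ_sqrt n).le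
    · rw [hK]; exact le_of_eq (by ring)
  obtain ⟨k, hk⟩ := ENat.ne_top_iff_exists.1 (ne_top_of_le_ne_top (ENat.natCast_ne_top _) hle)
  refine ⟨k, hk.symm, ?_⟩
  rw [← hk, Nat.cast_le] at hle
  have hn1 : 1 ≤ n := by
    rw [← hn, Nat.one_le_iff_ne_zero, Finset.card_ne_zero]
    obtain ⟨x, hx⟩ := hG.connected.1
    exact ⟨x, by simpa [hVdef] using hx⟩
  have h1 : (1 : ℝ) ≤ √(n : ℝ) := Real.one_le_sqrt.2 (by exact_mod_cast hn1)
  have h2 : (L : ℝ) ≤ 2 * √(n : ℝ) := by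
    have := Real.nat_sqrt_le_real_sqrt (a := n)
    rw [hL]; push_cast; linarith
  calc (k : ℝ) ≤ (((Δ + 1) * K : ℕ) : ℝ) := by exact_mod_cast hle
    _ = (Δ + 1) * ((r + 3) * (r + 3)) * (L : ℝ) := by rw [hK]; push_cast; ring
    _ ≤ (Δ + 1) * ((r + 3) * (r + 3)) * (2 * √(n : ℝ)) := by gcongr
    _ = _ := by ring

end Graph

namespace Graph

variable {α : Type u} {β : Type v} {G : Graph α β}

/-! ### From models of complete graphs to minors -/

lemma deleteEdges_isMinorOf (G : Graph α β) {D : Set β} (hD : D.Finite) :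
    (G.deleteEdges D).IsMinorOf G := by
  induction D, hD using Set.Finite.induction_on with
  | empty => rw [deleteEdges_empty]; exact .refl
  | @insert e D _ _ ih =>
    refine Relation.ReflTransGen.tail ih ?_
    rw [← Set.union_singleton, ← deleteEdges_deleteEdges]
    exact .deleteEdge _ e

/-- If all branch sets are single vertices and there are no other vertices, deleting superfluous
parallel edges yields a complete graph. -/
lemma hasCompleteMinor_of_spanning {r : ℕ} [G.Loopless] (hE : E(G).Finite) (p : Fin r → α)
    (hp : Function.Injective p) (hV : V(G) = Set.range p)
    (hadj : ∀ i j, i ≠ j → G.Adj (p i) (p j)) : G.HasCompleteMinor r := by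
  -- One edge is kept for each pair `i < j`; `D` consists of all the others.
  have : ∀ i j : Fin r, i < j → ∃ e, G.IsLink e (p i) (p j) := fun i j h ↦ hadj i j h.ne
  choose e he using this
  let D : Set β := {f | f ∈ E(G) ∧ ∀ i j h, f ≠ e i j h}
  have hkeep : ∀ i j h, e i j h ∉ D := fun i j h hD ↦ hD.2 i j h rfl
  refine ⟨G.deleteEdges D, G.deleteEdges_isMinorOf (hE.subset fun f hf ↦ hf.1), ?_, ?_, ?_⟩
  · have : (G.deleteEdges D).Loopless := Loopless.anti deleteEdges_le
    refine ⟨fun f g x y hf hg ↦ ?_⟩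
    rw [deleteEdges_isLink] at hf hg
    have hform : ∀ f, G.IsLink f x y ∧ f ∉ D → ∃ i j, ∃ h : i < j, f = e i j h := by
      rintro f ⟨hf, hfD⟩
      by_contra! hcon
      exact hfD ⟨hf.edge_mem, hcon⟩
    obtain ⟨i, j, hij, rfl⟩ := hform f hf
    obtain ⟨k, l, hkl, rfl⟩ := hform g hg
    have h1 := (he i j hij).eq_and_eq_or_eq_and_eq hf.1
    have h2 := (he k l hkl).eq_and_eq_or_eq_and_eq hg.1
    rcases h1 with ⟨rfl, rfl⟩ | ⟨rfl, rfl⟩ <;> rcases h2 with ⟨h, h'⟩ | ⟨h, h'⟩ <;>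
      obtain rfl := hp h <;> obtain rfl := hp h' <;> first | rfl | omega
  · rw [vertexSet_deleteEdges, hV, ← Set.image_univ, hp.encard_image, Set.encard_univ]
    simp
  · rw [vertexSet_deleteEdges, hV]
    rintro _ ⟨i, rfl⟩ _ ⟨j, rfl⟩ hij
    rcases lt_or_gt_of_ne (fun h ↦ hij (congrArg p h)) with h | h
    · exact ⟨e i j h, by rw [deleteEdges_isLink]; exact ⟨he i j h, hkeep i j h⟩⟩
    · exact ⟨e j i h, by rw [deleteEdges_isLink]; exact ⟨(he j i h).symm, hkeep j i h⟩⟩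

section Contract

open Classical in
/-- The map on vertices that merges `y` into `x`. -/
def mergeMap (x y z : α) : α := if z = y then x else z

lemma contract_adj {x y a b : α} (hab : G.Adj a b) (hne : mergeMap x y a ≠ mergeMap x y b) :
    (G.contract x y).Adj (mergeMap x y a) (mergeMap x y b) := by
  obtain ⟨f, hf⟩ := hab
  refine ⟨f, a, b, ?_, rfl, rfl⟩
  rw [deleteEdges_isLink]
  refine ⟨hf, fun hxy ↦ hne ?_⟩
  rcases hf.eq_and_eq_or_eq_and_eq hxy with ⟨rfl, rfl⟩ | ⟨rfl, rfl⟩ <;> simp [mergeMap]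

lemma contract_loopless [G.Loopless] (x y : α) : (G.contract x y).Loopless := by
  constructor
  rintro f z ⟨a, b, hab, ha, hb⟩
  rw [deleteEdges_isLink] at hab
  obtain ⟨hab, hxy⟩ := hab
  have hne := hab.ne
  have hxy' : ¬ G.IsLink f x y := hxy
  simp only [] at ha hb
  subst hb
  split_ifs at ha <;> subst_vars <;> first | exact hne rfl | exact hxy' hab | exact hxy' hab.symm

lemma edgeSet_contract_subset (x y : α) : E(G.contract x y) ⊆ E(G) := fun _ h ↦ h.1

end Contract

/-- A graph with a model of `K_r` has a `K_r` minor. -/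
theorem HasCompleteModel.hasCompleteMinor {r : ℕ} (hV : V(G).Finite) (hE : E(G).Finite)
    (hG : G.Loopless) (h : G.HasCompleteModel r) : G.HasCompleteMinor r := by
  induction hn : V(G).ncard using Nat.strong_induction_on generalizing G with
  | _ n ih =>
  obtain ⟨B, hBV, hBne, hBc, hBd, hBa⟩ := h
  have hdisj : ∀ i j z, z ∈ B i → z ∈ B j → i = j := fun i j z hi hj ↦ by
    by_contra hij
    exact Set.disjoint_left.1 (hBd i j hij) hi hj
  -- Each case loses a vertex: one outside all branch sets is deleted, or an edge inside a branch
  -- set is contracted. If neither is possible, the branch sets are singletons covering `V(G)`.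
  by_cases h1 : ∃ x ∈ V(G), ∀ i, x ∉ B i
  · obtain ⟨x, hx, hxB⟩ := h1
    have hle : G.deleteVerts {x} ≤ G := deleteVerts_le
    have hadj : ∀ i j, ∀ a ∈ B i, ∀ b ∈ B j, G.Adj a b → (G.deleteVerts {x}).Adj a b := by
      rintro i j a ha b hb ⟨e, he⟩
      refine ⟨e, ?_⟩
      rw [deleteVerts_isLink]
      exact ⟨he, fun h ↦ hxB i (h ▸ ha), fun h ↦ hxB j (h ▸ hb)⟩
    obtain ⟨H, hH, hHr⟩ := ih (V(G.deleteVerts {x})).ncard (by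
      rw [← hn, vertexSet_deleteVerts]
      exact Set.ncard_sdiff_singleton_lt_of_mem hx hV) (hV.subset hle.vertexSet_mono)
      (hE.subset hle.edgeSet_mono) (Loopless.anti hle)
      ⟨B, fun i z hz ↦ by
        rw [vertexSet_deleteVerts]
        exact ⟨hBV i hz, fun h ↦ hxB i (h ▸ hz)⟩, hBne, fun i a ha b hb ↦
        Relation.ReflTransGen.mono (fun c d hcd ↦
          ⟨hadj i i c hcd.2.1 d hcd.2.2 hcd.1, hcd.2⟩) _ _ (hBc i a ha b hb), hBd,
        fun i j hij ↦ by
          obtain ⟨a, ha, b, hb, hab⟩ := hBa i j hij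
          exact ⟨a, ha, b, hb, hadj i j a ha b hb hab⟩⟩ rfl
    exact ⟨H, .head (.deleteVertex G x) hH, hHr⟩
  by_cases h2 : ∃ i, ∃ x ∈ B i, ∃ y ∈ B i, x ≠ y
  · obtain ⟨i, x, hx, y₀, hy₀, hxy₀⟩ := h2
    obtain ⟨y, e, hy, he⟩ : ∃ y e, y ∈ B i ∧ G.IsLink e x y := by
      rcases Relation.ReflTransGen.cases_head (hBc i x hx y₀ hy₀) with h | ⟨y, ⟨⟨e, he⟩, -, hy⟩, -⟩
      · exact absurd h hxy₀
      · exact ⟨y, e, hy, he⟩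
    have hxy : x ≠ y := he.ne
    have hmB : ∀ j z, z ∈ B j → mergeMap x y z ∈ B j := by
      intro j z hz
      unfold mergeMap
      split_ifs with h
      · subst h; rwa [hdisj j i z hz hy]
      · exact hz
    have hsub : ∀ j, mergeMap x y '' B j ⊆ B j := by
      rintro j _ ⟨z, hz, rfl⟩
      exact hmB j z hz
    have hVsub : V(G.contract x y) ⊆ V(G) \ {y} := by
      rintro _ ⟨z, hz, rfl⟩
      simp only
      split_ifs with h
      · exact ⟨he.left_mem, hxy⟩
      · exact ⟨hz, h⟩
    have hmodel : (G.contract x y).HasCompleteModel r := by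
      refine ⟨fun j ↦ mergeMap x y '' B j, fun j ↦ Set.image_mono (hBV j),
        fun j ↦ (hBne j).image _, ?_, fun j k hjk ↦ (hBd j k hjk).mono (hsub j) (hsub k), ?_⟩
      · rintro j _ ⟨a, ha, rfl⟩ _ ⟨b, hb, rfl⟩
        have := hBc j a ha b hb
        clear hb
        induction this with
        | refl => exact .refl
        | @tail c d _ hcd ih =>
          refine ih.trans ?_
          -- A step along an edge whose ends are merged becomes trivial; any other step survives the
          -- contraction.
          by_cases hcd' : mergeMap x y c = mergeMap x y d
          · rw [hcd']
          · exact .single ⟨contract_adj hcd.1 hcd', ⟨c, hcd.2.1, rfl⟩, ⟨d, hcd.2.2, rfl⟩⟩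
      · intro j k hjk
        obtain ⟨a, ha, b, hb, hab⟩ := hBa j k hjk
        refine ⟨_, ⟨a, ha, rfl⟩, _, ⟨b, hb, rfl⟩, contract_adj hab fun h ↦ hjk ?_⟩
        exact hdisj j k _ (hmB j a ha) (h ▸ hmB k b hb)
    obtain ⟨H, hH, hHr⟩ := ih (V(G.contract x y)).ncard (by
      rw [← hn]
      exact (Set.ncard_le_ncard hVsub (hV.subset Set.sdiff_subset)).trans_lt
        (Set.ncard_sdiff_singleton_lt_of_mem he.right_mem hV))
      (hV.subset (hVsub.trans Set.sdiff_subset))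
      (hE.subset (edgeSet_contract_subset x y)) (contract_loopless x y) hmodel rfl
    exact ⟨H, .head (.contractEdge G e x y he) hH, hHr⟩
  · push Not at h1 h2
    choose p hp using hBne
    refine hasCompleteMinor_of_spanning hE p (fun i j hij ↦ hdisj i j _ (hp i) (hij ▸ hp j)) ?_ ?_
    · ext x
      constructor
      · intro hx
        obtain ⟨i, hi⟩ := h1 x hx
        exact ⟨i, h2 i _ (hp i) _ hi⟩
      · rintro ⟨i, rfl⟩
        exact hBV i (hp i)
    · intro i j hij
      obtain ⟨a, ha, b, hb, hab⟩ := hBa i j hij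
      rwa [h2 i _ (hp i) _ ha, h2 j _ (hp j) _ hb]

end Graph

/-! ### Five points in the plane cannot be joined by curves that are disjoint for disjoint pairs -/

section PlaneCurves

open Complex

/-- `z` is the change along the curve `γ` on `[0, 1]` of a continuous logarithm of `γ - w`. -/
def IsLogChange (γ : ℝ → ℂ) (w z : ℂ) : Prop :=
  ∃ l : ℝ → ℂ, Continuous l ∧ (∀ t, exp (l t) = γ t - w) ∧ z = l 1 - l 0

/-- Two continuous logarithms of one curve are lifts through the covering map `exp`, hence differ by
a constant. -/
lemma IsLogChange.unique {γ : ℝ → ℂ} {w z z' : ℂ} (h : IsLogChange γ w z)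
    (h' : IsLogChange γ w z') : z = z' := by
  obtain ⟨f, hf, hfe, rfl⟩ := h
  obtain ⟨g, hg, hge, rfl⟩ := h'
  have : f = fun t ↦ g t + (f 0 - g 0) := by
    refine isCoveringMap_exp.eq_of_comp_eq hf (by fun_prop) ?_ 0 (by simp)
    funext t
    simp only [Function.comp_apply, Subtype.mk.injEq, exp_add, exp_sub, hfe, hge]
    have := exp_ne_zero (g 0)
    rw [hge] at this
    rw [div_self this, mul_one]
  have h1 := congrFun this 1
  rw [h1]; ring

lemma exists_continuous_log {F : ℝ × ℝ → ℂ} (hF : Continuous F) (h0 : ∀ x, F x ≠ 0) :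
    ∃ l : ℝ × ℝ → ℂ, Continuous l ∧ ∀ x, exp (l x) = F x := by
  obtain ⟨l, ⟨-, hl⟩, -⟩ := isCoveringMapOn_exp.existsUnique_continuousMap_lifts
    (⟨F, hF⟩ : C(ℝ × ℝ, ℂ)) (a₀ := 0) (exp_log (h0 0)) (fun x ↦ h0 x)
  exact ⟨l, l.continuous, fun x ↦ congrFun hl x⟩

/-- For disjoint curves, `g t - f s` has a continuous logarithm on the whole plane, and its total
change around the unit square vanishes. The four sides are the four logarithm changes; the shift by
`π * I` turns `g - f` into `f - g`. -/
lemma exists_isLogChange_square {f g : ℝ → ℂ} (hf : Continuous f) (hg : Continuous g)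
    (hfg : ∀ s t, f s ≠ g t) : ∃ z₀ z₁ z₂ z₃, IsLogChange g (f 0) z₀ ∧ IsLogChange g (f 1) z₁ ∧
      IsLogChange f (g 0) z₂ ∧ IsLogChange f (g 1) z₃ ∧ z₀ - z₁ = z₂ - z₃ := by
  obtain ⟨l, hl, hle⟩ := exists_continuous_log (F := fun x ↦ g x.2 - f x.1) (by fun_prop)
    fun x ↦ sub_ne_zero.2 (hfg _ _).symm
  have hneg : ∀ s t, exp (l (s, t) + Real.pi * I) = f s - g t := fun s t ↦ by
    rw [exp_add, exp_pi_mul_I, hle]; ring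
  refine ⟨l (0, 1) - l (0, 0), l (1, 1) - l (1, 0), l (1, 0) - l (0, 0), l (1, 1) - l (0, 1),
    ⟨fun t ↦ l (0, t), by fun_prop, fun t ↦ hle _, rfl⟩,
    ⟨fun t ↦ l (1, t), by fun_prop, fun t ↦ hle _, rfl⟩,
    ⟨fun s ↦ l (s, 0) + Real.pi * I, by fun_prop, fun s ↦ hneg s 0, by ring⟩,
    ⟨fun s ↦ l (s, 1) + Real.pi * I, by fun_prop, fun s ↦ hneg s 1, by ring⟩, by ring⟩

theorem not_forall_disjoint_paths (p : Fin 5 → ℂ) (γ : ∀ i j, Path (p i) (p j))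
    (h : ∀ i j k l, i ≠ j → i ≠ k → i ≠ l → j ≠ k → j ≠ l → k ≠ l →
      Disjoint (Set.range (γ i j)) (Set.range (γ k l))) : False := by
  classical
  have hsq : ∀ i j k l, i ≠ j → i ≠ k → i ≠ l → j ≠ k → j ≠ l → k ≠ l →
      ∃ z₀ z₁ z₂ z₃, IsLogChange (γ k l).extend (p i) z₀ ∧ IsLogChange (γ k l).extend (p j) z₁ ∧
      IsLogChange (γ i j).extend (p k) z₂ ∧ IsLogChange (γ i j).extend (p l) z₃ ∧
      z₀ - z₁ = z₂ - z₃ := by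
    intro i j k l h1 h2 h3 h4 h5 h6
    have := exists_isLogChange_square (γ i j).continuous_extend (γ k l).continuous_extend
      (fun s t hst ↦ Set.disjoint_left.1 (h i j k l h1 h2 h3 h4 h5 h6)
        (show (γ i j).extend s ∈ _ by rw [← Path.extend_range]; exact ⟨s, rfl⟩)
        (by rw [hst, ← Path.extend_range]; exact ⟨t, rfl⟩))
    simpa using this
  -- `A i k l` is the logarithm change along the curve from `p k` to `p l`, seen from `p i`. The
  -- default 0 never matters for distinct indices.
  let A : Fin 5 → Fin 5 → Fin 5 → ℂ := fun i k l ↦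
    if hz : ∃ z, IsLogChange (γ k l).extend (p i) z then hz.choose else 0
  have hA : ∀ i k l z, IsLogChange (γ k l).extend (p i) z → A i k l = z := by
    intro i k l z hz
    have hex : ∃ z, IsLogChange (γ k l).extend (p i) z := ⟨z, hz⟩
    simp only [A, dif_pos hex]
    exact hex.choose_spec.unique hz
  have hA1 : ∀ i j k l, i ≠ j → i ≠ k → i ≠ l → j ≠ k → j ≠ l → k ≠ l →
      A i k l - A j k l = A k i j - A l i j := by
    intro i j k l h1 h2 h3 h4 h5 h6
    obtain ⟨z₀, z₁, z₂, z₃, hz₀, hz₁, hz₂, hz₃, hz⟩ := hsq i j k l h1 h2 h3 h4 h5 h6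
    rw [hA _ _ _ _ hz₀, hA _ _ _ _ hz₁, hA _ _ _ _ hz₂, hA _ _ _ _ hz₃, hz]
  have hp : ∀ i j, i ≠ j → p i - p j ≠ 0 := by
    intro i j hij h0
    obtain ⟨k, l, h2, h3, h4, h5, h6⟩ : ∃ k l, i ≠ k ∧ i ≠ l ∧ j ≠ k ∧ j ≠ l ∧ k ≠ l := by
      clear h0
      revert i j; decide
    exact Set.disjoint_left.1 (h i k j l h2 hij h3 h4.symm h6 h5)
      (show p i ∈ _ from ⟨0, by simp⟩) ⟨0, by simp [sub_eq_zero.1 h0]⟩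
  have hA2 : ∀ i k l, i ≠ k → i ≠ l → k ≠ l → exp (A i k l) * (p k - p i) = p l - p i := by
    intro i k l h2 h3 h6
    obtain ⟨j, h1, h4, h5⟩ : ∃ j, i ≠ j ∧ j ≠ k ∧ j ≠ l := by revert i k l; decide
    obtain ⟨z₀, z₁, z₂, z₃, ⟨f, hf, hfe, rfl⟩, -⟩ := hsq i j k l h1 h2 h3 h4 h5 h6
    rw [hA _ _ _ _ ⟨f, hf, hfe, rfl⟩, exp_sub, hfe, hfe]
    simp only [Path.extend_zero, Path.extend_one]
    exact div_mul_cancel₀ _ (hp k i h2.symm)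
  -- `θ i j` is a logarithm of `p j - p i`, chosen so that `θ j i` and `θ i j` differ by exactly `±
  -- π * I`. Then `A i k l` is `θ i l - θ i k` up to a multiple `N i k l` of `2 * π * I`.
  let θ : Fin 5 → Fin 5 → ℂ := fun i j ↦
    if i < j then log (p j - p i) else log (p i - p j) + Real.pi * I
  let ε : Fin 5 → Fin 5 → ℤ := fun i j ↦ if i < j then 1 else -1
  have hθ : ∀ i j, i ≠ j → exp (θ i j) = p j - p i := by
    intro i j hij
    simp only [θ]
    split_ifs
    · exact exp_log (hp j i hij.symm)
    · rw [exp_add, exp_log (hp i j hij), exp_pi_mul_I]; ring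
  have hε : ∀ i j, i ≠ j → θ j i - θ i j = ε i j * (Real.pi * I) := by
    intro i j hij
    simp only [θ, ε]
    rcases lt_or_gt_of_ne hij with h | h
    · simp [h, h.not_gt]
    · simp [h, h.not_gt]
  have hN : ∀ i k l, ∃ N : ℤ, i ≠ k → i ≠ l → k ≠ l →
      A i k l = θ i l - θ i k + N * (2 * Real.pi * I) := by
    intro i k l
    by_cases hikl : i ≠ k ∧ i ≠ l ∧ k ≠ l
    · obtain ⟨h2, h3, h6⟩ := hikl
      have : exp (A i k l) = exp (θ i l - θ i k) := by
        rw [exp_sub, hθ i l h3, hθ i k h2, eq_div_iff (hp k i h2.symm), hA2 i k l h2 h3 h6]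
      obtain ⟨N, hN⟩ := exp_eq_exp_iff_exists_int.1 this
      exact ⟨N, fun _ _ _ ↦ hN⟩
    · exact ⟨0, fun a b c ↦ absurd ⟨a, b, c⟩ hikl⟩
  choose N hN using hN
  have key : ∀ i j k l, i ≠ j → i ≠ k → i ≠ l → j ≠ k → j ≠ l → k ≠ l →
      ε i k - ε i l + ε j l - ε j k + 2 * (N i k l - N j k l - N k i j + N l i j) = 0 := by
    intro i j k l h1 h2 h3 h4 h5 h6
    have e := hA1 i j k l h1 h2 h3 h4 h5 h6
    rw [hN i k l h2 h3 h6, hN j k l h4 h5 h6, hN k i j h2.symm h4.symm h1,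
      hN l i j h3.symm h5.symm h1] at e
    have hpi : (Real.pi * I : ℂ) ≠ 0 := mul_ne_zero (by exact_mod_cast Real.pi_ne_zero) I_ne_zero
    have : ((ε i k - ε i l + ε j l - ε j k +
        2 * (N i k l - N j k l - N k i j + N l i j) : ℤ) : ℂ) * (Real.pi * I) = 0 := by
      push_cast
      linear_combination e - hε i k h2 + hε i l h3 - hε j l h5 + hε j k h4
    exact_mod_cast (mul_eq_zero.1 this).resolve_right hpi
  have e : ∀ i j : Fin 5, ε i j = if i < j then 1 else -1 := fun _ _ ↦ rfl
  -- These are the fifteen pairs of disjoint pairs. In the sum of all equations every `N i k l` with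
  -- `k < l` occurs twice, each time with coefficient `± 2`, so the `N` vanish modulo 4. The `ε`
  -- terms give 2 for each of the five interleaved pairs and 0 otherwise, in total 10, which is not
  -- divisible by 4.
  have k1 := key 0 1 2 3 (by decide) (by decide) (by decide) (by decide) (by decide) (by decide)
  have k2 := key 0 1 2 4 (by decide) (by decide) (by decide) (by decide) (by decide) (by decide)
  have k3 := key 0 1 3 4 (by decide) (by decide) (by decide) (by decide) (by decide) (by decide)
  have k4 := key 0 2 1 3 (by decide) (by decide) (by decide) (by decide) (by decide) (by decide)
  have k5 := key 0 2 1 4 (by decide) (by decide) (by decide) (by decide) (by decide) (by decide)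
  have k6 := key 0 2 3 4 (by decide) (by decide) (by decide) (by decide) (by decide) (by decide)
  have k7 := key 0 3 1 2 (by decide) (by decide) (by decide) (by decide) (by decide) (by decide)
  have k8 := key 0 3 1 4 (by decide) (by decide) (by decide) (by decide) (by decide) (by decide)
  have k9 := key 0 3 2 4 (by decide) (by decide) (by decide) (by decide) (by decide) (by decide)
  have k10 := key 0 4 1 2 (by decide) (by decide) (by decide) (by decide) (by decide) (by decide)
  have k11 := key 0 4 1 3 (by decide) (by decide) (by decide) (by decide) (by decide) (by decide)
  have k12 := key 0 4 2 3 (by decide) (by decide) (by decide) (by decide) (by decide) (by decide)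
  have k13 := key 1 2 3 4 (by decide) (by decide) (by decide) (by decide) (by decide) (by decide)
  have k14 := key 1 3 2 4 (by decide) (by decide) (by decide) (by decide) (by decide) (by decide)
  have k15 := key 1 4 2 3 (by decide) (by decide) (by decide) (by decide) (by decide) (by decide)
  simp only [e] at k1 k2 k3 k4 k5 k6 k7 k8 k9 k10 k11 k12 k13 k14 k15
  norm_num [Fin.lt_def] at k1 k2 k3 k4 k5 k6 k7 k8 k9 k10 k11 k12 k13 k14 k15
  omega

end PlaneCurves

namespace Graph

variable {α : Type u} {β : Type v} {G : Graph α β}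

/-! ### Planar graphs have no `K_5` model -/

namespace PlaneDrawing

variable (D : G.PlaneDrawing)

/-- The part of a plane drawing spanned by a set of vertices. -/
def support (U : Set α) : Set (EuclideanSpace ℝ (Fin 2)) :=
  {q | (∃ x ∈ U, q = D.point x) ∨ ∃ e x y, G.IsLink e x y ∧ x ∈ U ∧ y ∈ U ∧
    ∃ t, t ≠ 0 ∧ t ≠ 1 ∧ q = D.arc e t}

lemma point_mem_support {U : Set α} {x : α} (hx : x ∈ U) : D.point x ∈ D.support U :=
  .inl ⟨x, hx, rfl⟩

lemma disjoint_support {U U' : Set α} (hU : U ⊆ V(G)) (hU' : U' ⊆ V(G)) (h : Disjoint U U') :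
    Disjoint (D.support U) (D.support U') := by
  have hne : ∀ x, x ∈ U → x ∉ U' := fun _ hx ↦ Set.disjoint_left.1 h hx
  rw [Set.disjoint_left]
  rintro q (⟨x, hx, rfl⟩ | ⟨e, x, y, he, hx, hy, t, ht0, ht1, rfl⟩)
    (⟨x', hx', hq⟩ | ⟨e', x', y', he', hx', hy', t', ht0', ht1', hq⟩)
  · exact hne x hx (D.point_injOn (hU hx) (hU' hx') hq ▸ hx')
  · exact D.arc_ne_point e' he'.edge_mem t' ht0' ht1' x (hU hx) hq.symm
  · exact D.arc_ne_point e he.edge_mem t ht0 ht1 x' (hU' hx') hq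
  · refine D.arc_ne_arc e he.edge_mem e' he'.edge_mem ?_ t ht0 ht1 t' ht0' ht1' hq
    rintro rfl
    rcases he.left_eq_or_eq he' with rfl | rfl
    · exact hne _ hx hx'
    · exact hne _ hx hy'

lemma joinedIn_support_of_isLink {U : Set α} {e : β} {x y : α} (he : G.IsLink e x y) (hx : x ∈ U)
    (hy : y ∈ U) : JoinedIn (D.support U) (D.point x) (D.point y) := by
  obtain ⟨x', y', he', h0, h1⟩ := D.arc_ends e he.edge_mem
  have hmem : ∀ t, D.arc e t ∈ D.support U := by
    intro t
    have hxy' : x' ∈ U ∧ y' ∈ U := by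
      rcases he.eq_and_eq_or_eq_and_eq he' with ⟨rfl, rfl⟩ | ⟨rfl, rfl⟩
      · exact ⟨hx, hy⟩
      · exact ⟨hy, hx⟩
    by_cases ht0 : t = 0
    · rw [ht0, h0]; exact D.point_mem_support hxy'.1
    by_cases ht1 : t = 1
    · rw [ht1, h1]; exact D.point_mem_support hxy'.2
    exact .inr ⟨e, x, y, he, hx, hy, t, ht0, ht1, rfl⟩
  have hj : JoinedIn (D.support U) (D.point x') (D.point y') :=
    ⟨⟨D.arc e, h0, h1⟩, hmem⟩
  rcases he.eq_and_eq_or_eq_and_eq he' with ⟨rfl, rfl⟩ | ⟨rfl, rfl⟩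
  · exact hj
  · exact hj.symm

lemma joinedIn_support {U : Set α} (hU : ConnectedOn G.Adj U) {x y : α} (hx : x ∈ U)
    (hy : y ∈ U) : JoinedIn (D.support U) (D.point x) (D.point y) :=
  hU.induction (P := fun y ↦ JoinedIn (D.support U) (D.point x) (D.point y)) hx
    (JoinedIn.refl (D.point_mem_support hx))
    (fun _ _ ⟨_, he⟩ ha hb h ↦ h.trans (D.joinedIn_support_of_isLink he ha hb)) y hy

end PlaneDrawing

/-- A planar graph has no model of `K_5`. -/
theorem IsPlanar.not_hasCompleteModel (hG : G.IsPlanar) : ¬ G.HasCompleteModel 5 := by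
  rintro ⟨B, hBV, hBne, hBc, hBd, hBa⟩
  obtain ⟨D⟩ := hG
  choose x hx using hBne
  have hconn : ∀ i j, ConnectedOn G.Adj (B i ∪ B j) := by
    intro i j
    rcases eq_or_ne i j with rfl | hij
    · rw [Set.union_self]; exact hBc i
    · obtain ⟨a, ha, b, hb, hab⟩ := hBa i j hij
      exact (hBc i).union adj_symm' (hBc j) ha hb hab
  have hjoin : ∀ i j, JoinedIn (D.support (B i ∪ B j)) (D.point (x i)) (D.point (x j)) :=
    fun i j ↦ D.joinedIn_support (hconn i j) (.inl (hx i)) (.inr (hx j))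
  let φ : EuclideanSpace ℝ (Fin 2) → ℂ := Complex.orthonormalBasisOneI.repr.symm
  have hφ : Continuous φ := Complex.orthonormalBasisOneI.repr.symm.continuous
  have hφi : Function.Injective φ := Complex.orthonormalBasisOneI.repr.symm.injective
  refine not_forall_disjoint_paths (fun i ↦ φ (D.point (x i)))
    (fun i j ↦ (hjoin i j).somePath.map hφ) ?_
  intro i j k l _ h2 h3 h4 h5 _
  -- Each curve stays in the drawing of the union of its two branch sets, so four different indices
  -- give disjoint curves.
  have hdisj : Disjoint (B i ∪ B j) (B k ∪ B l) := by
    simp only [Set.disjoint_union_left, Set.disjoint_union_right]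
    exact ⟨⟨hBd i k h2, hBd j k h4⟩, hBd i l h3, hBd j l h5⟩
  have hS := D.disjoint_support (Set.union_subset (hBV i) (hBV j))
    (Set.union_subset (hBV k) (hBV l)) hdisj
  rw [Set.disjoint_left]
  rintro _ ⟨s, rfl⟩ ⟨t, ht⟩
  have := hφi ht
  exact Set.disjoint_left.1 hS ((hjoin i j).somePath_mem s) (this ▸ (hjoin k l).somePath_mem t)

end Graph

/-! ### Linear algebra -/

section LinearAlgebra

variable {k M N : Type*} [Field k] [AddCommGroup M] [Module k M] [FiniteDimensional k M]
  [AddCommGroup N] [Module k N]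

lemma Submodule.finrank_map_add_finrank_inf_ker (f : M →ₗ[k] N) (Z : Submodule k M) :
    Module.finrank k (Z.map f) + Module.finrank k ↥(Z ⊓ LinearMap.ker f) =
      Module.finrank k Z := by
  have h := (f.domRestrict Z).finrank_range_add_finrank_ker
  rw [LinearMap.range_domRestrict] at h
  have h2 : Submodule.map Z.subtype (LinearMap.ker (f.domRestrict Z)) = Z ⊓ LinearMap.ker f := by
    rw [← Submodule.map_comap_subtype]
    rfl
  rw [← h, ← h2, Submodule.finrank_map_subtype_eq]

/-- The codimension of `B` in `Z` does not increase under intersections with a subspace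
followed by linear maps. -/
lemma Submodule.finrank_map_inf_add_le {B Z : Submodule k M} (hBZ : B ≤ Z) (W : Submodule k M)
    (f : M →ₗ[k] N) :
    Module.finrank k ((Z ⊓ W).map f) + Module.finrank k B ≤
      Module.finrank k ((B ⊓ W).map f) + Module.finrank k Z := by
  have h1 := Submodule.finrank_map_add_finrank_inf_ker f (Z ⊓ W)
  have h2 := Submodule.finrank_map_add_finrank_inf_ker f (B ⊓ W)
  have h3 : Module.finrank k ↥(B ⊓ W ⊓ LinearMap.ker f) ≤
      Module.finrank k ↥(Z ⊓ W ⊓ LinearMap.ker f) :=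
    Submodule.finrank_mono (inf_le_inf_right _ (inf_le_inf_right _ hBZ))
  have h4 := Submodule.finrank_sup_add_finrank_inf_eq B (Z ⊓ W)
  have h5 : Module.finrank k ↥(B ⊔ Z ⊓ W) ≤ Module.finrank k Z :=
    Submodule.finrank_mono (sup_le hBZ inf_le_left)
  rw [← inf_assoc, inf_eq_left.2 hBZ] at h4
  omega

/-- The rank of a family of vectors is at most the number of its nonzero members. -/
lemma LinearMap.finrank_range_le_card_ne_zero {ι : Type*} [Fintype ι] [DecidableEq ι]
    [FiniteDimensional k N] [DecidableEq N] (T : (ι → k) →ₗ[k] N) :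
    Module.finrank k (LinearMap.range T) ≤
      (Finset.univ.filter fun i ↦ T (Pi.single i 1) ≠ 0).card := by
  have hle : LinearMap.range T ≤ Submodule.span k
      (((Finset.univ.filter fun i ↦ T (Pi.single i 1) ≠ 0).image
        fun i ↦ T (Pi.single i 1) : Finset N) : Set N) := by
    rintro _ ⟨x, rfl⟩
    rw [pi_eq_sum_univ' x, map_sum]
    refine Submodule.sum_mem _ fun i _ ↦ ?_
    rw [map_smul]
    refine Submodule.smul_mem _ _ ?_
    by_cases h : T (Pi.single i 1) = 0
    · convert Submodule.zero_mem _
    · exact Submodule.subset_span (by simpa using ⟨i, h, rfl⟩)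
  exact (Submodule.finrank_mono hle).trans
    ((finrank_span_finset_le_card _).trans Finset.card_image_le)

end LinearAlgebra

namespace Graph

variable {α : Type u} {β : Type v} {G : Graph α β}

lemma add_self_zmod_two {X : Type*} (f : X → ZMod 2) : f + f = 0 :=
  funext fun x ↦ CharTwo.add_self_eq_zero (f x)

/-! ### The cycle space -/

section CycleSpace

open Classical

/-- The boundary map from sets of edges to sets of vertices, modulo 2. -/
def boundary (G : Graph α β) [Fintype E(G)] : (E(G) → ZMod 2) →ₗ[ZMod 2] (V(G) → ZMod 2) where
  toFun z x := ∑ e : E(G), if G.Inc e x then z e else 0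
  map_add' z w := by
    ext x
    simp only [Pi.add_apply, ← Finset.sum_add_distrib]
    exact Finset.sum_congr rfl fun e _ ↦ by split_ifs <;> simp
  map_smul' c z := by
    ext x
    simp only [Pi.smul_apply, smul_eq_mul, RingHom.id_apply, Finset.mul_sum]
    exact Finset.sum_congr rfl fun e _ ↦ by split_ifs <;> simp

lemma boundary_apply [Fintype E(G)] (z : E(G) → ZMod 2) (x : V(G)) :
    G.boundary z x = ∑ e : E(G), if G.Inc e x then z e else 0 := rfl

/-- The indicator function of a vertex. -/
def vertexIndicator (G : Graph α β) (x : α) : V(G) → ZMod 2 := fun v ↦ if v.1 = x then 1 else 0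

lemma boundary_single [Fintype E(G)] [G.Loopless] (e : E(G)) {x y : α} (h : G.IsLink e x y) :
    G.boundary (Pi.single e 1) = G.vertexIndicator x + G.vertexIndicator y := by
  ext v
  rw [boundary_apply, Finset.sum_eq_single e (fun f _ hf ↦ by simp [Pi.single_eq_of_ne hf])
    (by simp)]
  simp only [Pi.single_eq_same, vertexIndicator, Pi.add_apply]
  have hne := h.ne
  have hiff : G.Inc e v ↔ v.1 = x ∨ v.1 = y :=
    ⟨fun hv ↦ hv.eq_or_eq_of_isLink h, fun hv ↦ by
      rcases hv with hv | hv <;> rw [hv]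
      exacts [h.inc_left, h.inc_right]⟩
  rw [hiff]
  by_cases h1 : v.1 = x
  · have h2 : v.1 ≠ y := h1 ▸ hne
    simp [h1, hne]
  · simp [h1]

/-- In a connected set, any two vertices are the boundary of a set of edges. -/
lemma ConnectedOn.exists_boundary_eq [Fintype E(G)] [G.Loopless] {U : Set α}
    (hU : ConnectedOn G.Adj U) {x y : α} (hx : x ∈ U) (hy : y ∈ U) : ∃ z : E(G) → ZMod 2,
      (∀ (f : E(G)) (w : α), G.Inc f w → w ∉ U → z f = 0) ∧
      G.boundary z = G.vertexIndicator x + G.vertexIndicator y := by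
  refine hU.induction (P := fun y ↦ ∃ z : E(G) → ZMod 2,
    (∀ (f : E(G)) (w : α), G.Inc f w → w ∉ U → z f = 0) ∧
      G.boundary z = G.vertexIndicator x + G.vertexIndicator y) hx ?_ ?_ y hy
  · exact ⟨0, fun _ _ _ _ ↦ rfl, by rw [map_zero, add_self_zmod_two]⟩
  · rintro a b ⟨e, he⟩ ha hb ⟨z, hz, hzb⟩
    refine ⟨z + Pi.single ⟨e, he.edge_mem⟩ 1, fun f w hfw hw ↦ ?_, ?_⟩
    · rw [Pi.add_apply, hz f w hfw hw, zero_add, Pi.single_eq_of_ne]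
      rintro rfl
      rcases hfw.eq_or_eq_of_isLink he with rfl | rfl
      exacts [hw ha, hw hb]
    · rw [map_add, hzb, boundary_single ⟨e, he.edge_mem⟩ he, add_assoc,
        ← add_assoc (G.vertexIndicator a), add_self_zmod_two, zero_add]

lemma Connected.connectedOn (hG : G.Connected) : ConnectedOn G.Adj V(G) := fun x hx y hy ↦
  Relation.ReflTransGen.mono (fun _ _ h ↦ ⟨h, h.left_mem, h.right_mem⟩) _ _ (hG.2 x hx y hy)

/-- The dimension of the cycle space of a connected graph. -/
lemma Connected.finrank_ker_boundary_add_le [Fintype E(G)] [G.Loopless] [Fintype V(G)]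
    (hG : G.Connected) :
    Module.finrank (ZMod 2) (LinearMap.ker G.boundary) + Fintype.card V(G) ≤
      Fintype.card E(G) + 1 := by
  have h1 := G.boundary.finrank_range_add_finrank_ker
  rw [Module.finrank_fintype_fun_eq_card] at h1
  let s : (V(G) → ZMod 2) →ₗ[ZMod 2] ZMod 2 := Fintype.linearCombination (ZMod 2) fun _ ↦ 1
  have h2 := s.finrank_range_add_finrank_ker
  rw [Module.finrank_fintype_fun_eq_card] at h2
  have h3 : Module.finrank (ZMod 2) (LinearMap.range s) ≤ 1 := by
    simpa using Submodule.finrank_le (LinearMap.range s)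
  have h4 : LinearMap.ker s ≤ LinearMap.range G.boundary := by
    -- A vector with coordinate sum zero is a combination of sums of two vertex indicators, and
    -- these are boundaries by connectedness. Hence the boundary map has rank at least the number of
    -- vertices minus one.
    intro u hu
    obtain ⟨x₀, hx₀⟩ := hG.1
    have hu' : ∑ x, u x = 0 := by simpa [s, Fintype.linearCombination_apply] using hu
    have hsum : u = ∑ x, u x • (G.vertexIndicator x.1 + G.vertexIndicator x₀) := by
      simp only [smul_add, Finset.sum_add_distrib, ← Finset.sum_smul, hu', zero_smul, add_zero]
      ext v
      simp only [Finset.sum_apply, Pi.smul_apply, vertexIndicator, smul_eq_mul, mul_ite, mul_one,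
        mul_zero]
      rw [Finset.sum_eq_single v (fun w _ hw ↦ if_neg fun h ↦ hw (Subtype.ext h.symm)) (by simp)]
      simp
    rw [hsum]
    refine Submodule.sum_mem _ fun x _ ↦ Submodule.smul_mem _ _ ?_
    obtain ⟨z, -, hz⟩ := ConnectedOn.exists_boundary_eq hG.connectedOn x.2 hx₀
    exact ⟨z, hz⟩
  have h5 := Submodule.finrank_mono h4
  omega

end CycleSpace

end Graph

/-! ### Boundaries of faces modulo 2, before and after the deletion of edges -/

namespace Graph

variable {α : Type u} {β : Type v} {G : Graph α β}

section FaceBoundary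

open Classical

/-- The flag at a chosen end of an edge, on a given side. -/
def edgeFlag (e : E(G)) (s : Bool) : G.Flag :=
  ⟨(e, (G.exists_isLink_of_mem_edgeSet e.2).choose, s),
    (G.exists_isLink_of_mem_edgeSet e.2).choose_spec⟩

/-- The edge of a flag. -/
def Flag.edge (f : G.Flag) : E(G) := ⟨f.1.1, f.2.edge_mem⟩

lemma Flag.isLink_vertex_flipEnd (f : G.Flag) : G.IsLink f.edge f.vertex f.flipEnd.vertex :=
  f.2.isLink_other

/-- The two flags on one side of an edge are exchanged by `flipEnd`, so the end chosen in `edgeFlag`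
is immaterial for such `c`. -/
lemma Flag.apply_eq_apply_edgeFlag {X : Type*} {c : G.Flag → X} (hc : ∀ f, c f.flipEnd = c f)
    (f : G.Flag) : c f = c (edgeFlag f.edge f.1.2.2) := by
  obtain ⟨⟨e, x, s⟩, hf⟩ := f
  have he := hf.edge_mem
  set g : G.Flag := edgeFlag ⟨e, he⟩ s with hg
  have hgl : G.IsLink e g.vertex g.flipEnd.vertex := g.isLink_vertex_flipEnd
  change c _ = c g
  rcases Inc.eq_or_eq_of_isLink hf hgl with h | h
  · exact congrArg c (Subtype.ext (Prod.ext rfl (Prod.ext h rfl)))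
  · rw [← hc g]
    exact congrArg c (Subtype.ext (Prod.ext rfl (Prod.ext h rfl)))

/-- The boundary, modulo 2, of a union of classes of flags, where `c` assigns its class to
every flag. -/
def classBoundary {X : Type*} (c : G.Flag → X) : (X → ZMod 2) →ₗ[ZMod 2] (E(G) → ZMod 2) where
  toFun S e := S (c (edgeFlag e false)) + S (c (edgeFlag e true))
  map_add' S T := by ext e; simp only [Pi.add_apply]; ring
  map_smul' a S := by ext e; simp only [Pi.smul_apply, smul_eq_mul, RingHom.id_apply]; ring

lemma classBoundary_apply {X : Type*} (c : G.Flag → X) (S : X → ZMod 2) (e : E(G)) :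
    classBoundary c S e = S (c (edgeFlag e false)) + S (c (edgeFlag e true)) := rfl

/-- The functions on edges that vanish on `D`. -/
def vanishingOn (D : Set E(G)) : Submodule (ZMod 2) (E(G) → ZMod 2) where
  carrier := {z | ∀ e ∈ D, z e = 0}
  add_mem' {a b} ha hb e he := by rw [Pi.add_apply, ha e he, hb e he, add_zero]
  zero_mem' _ _ := rfl
  smul_mem' a z hz e he := by rw [Pi.smul_apply, hz e he, smul_zero]

namespace CellularEmbedding

variable (M : G.CellularEmbedding)

/-- At each vertex, `turn` is an involution without fixed points on the flags there and preserves
their classes, so the contributions cancel in pairs modulo 2. -/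
lemma boundary_classBoundary [Fintype E(G)] {X : Type*} {c : G.Flag → X}
    (hc : ∀ f, c f.flipEnd = c f) (hturn : ∀ f, c (M.turn f) = c f) (S : X → ZMod 2) :
    G.boundary (classBoundary c S) = 0 := by
  ext x
  rw [boundary_apply, Pi.zero_apply]
  let h : E(G) × Bool → ZMod 2 := fun p ↦ S (c (edgeFlag p.1 p.2))
  have h1 : (∑ e : E(G), if G.Inc e x then classBoundary c S e else 0) =
      ∑ p ∈ Finset.univ.filter fun p : E(G) × Bool ↦ G.Inc p.1 x, h p := by
    rw [Finset.sum_filter, Fintype.sum_prod_type]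
    refine Finset.sum_congr rfl fun e _ ↦ ?_
    simp only [Fintype.sum_bool, h, classBoundary_apply]
    split_ifs
    · rw [add_comm]
    · simp
  rw [h1]
  let fl : ∀ p : E(G) × Bool, G.Inc p.1 x → G.Flag := fun p hp ↦ ⟨(p.1, x, p.2), hp⟩
  have hfl : ∀ p hp, S (c (fl p hp)) = h p := fun p hp ↦
    congrArg S (Flag.apply_eq_apply_edgeFlag hc (fl p hp))
  have hmem : ∀ p hp, G.Inc (M.turn (fl p hp)).edge x := fun p hp ↦ by
    have h2 : (M.turn (fl p hp)).vertex = x := M.vertex_turn (fl p hp)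
    have h3 := (M.turn (fl p hp)).isLink_vertex_flipEnd.inc_left
    rwa [h2] at h3
  have hback : ∀ p hp hq, fl ((M.turn (fl p hp)).edge, (M.turn (fl p hp)).1.2.2) hq =
      M.turn (fl p hp) := fun p hp hq ↦
    Subtype.ext (Prod.ext rfl (Prod.ext (M.vertex_turn (fl p hp)).symm rfl))
  refine Finset.sum_involution (fun p hp ↦ ((M.turn (fl p (Finset.mem_filter.1 hp).2)).edge,
    (M.turn (fl p (Finset.mem_filter.1 hp).2)).1.2.2)) ?_ ?_ ?_ ?_
  · intro p hp
    have hp' := (Finset.mem_filter.1 hp).2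
    rw [← hfl p hp', ← hfl _ (hmem p hp'), hback p hp', hturn, CharTwo.add_self_eq_zero]
  · intro p hp _ heq
    have hp' := (Finset.mem_filter.1 hp).2
    refine M.turn_ne (fl p hp') ?_
    rw [← hback p hp' (hmem p hp')]
    congr 1
  · intro p hp
    exact Finset.mem_filter.2 ⟨Finset.mem_univ _, hmem p _⟩
  · intro p hp
    have hp' := (Finset.mem_filter.1 hp).2
    have h4 : M.turn (fl ((M.turn (fl p hp')).edge, (M.turn (fl p hp')).1.2.2)
        (hmem p hp')) = fl p hp' := by rw [hback p hp', M.turn_turn]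
    refine Prod.ext (Subtype.ext ?_) ?_
    · exact congrArg (fun f : G.Flag ↦ f.1.1) h4
    · exact congrArg (fun f : G.Flag ↦ f.1.2.2) h4

/-- The face of a flag. -/
def face (f : G.Flag) : M.Face := Quot.mk _ f

lemma exists_face_eq (q : M.Face) : ∃ f, M.face f = q := Quot.exists_rep q

lemma face_flipEnd (f : G.Flag) : M.face f.flipEnd = M.face f :=
  Eq.symm <| Quot.sound (r := fun a b : G.Flag ↦ b = M.turn a ∨ b = a.flipEnd) (a := f)
    (Or.inr rfl)

lemma face_turn (f : G.Flag) : M.face (M.turn f) = M.face f :=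
  Eq.symm <| Quot.sound (r := fun a b : G.Flag ↦ b = M.turn a ∨ b = a.flipEnd) (a := f)
    (Or.inl rfl)

/-- Zero boundary means that `S` takes the same value on both sides of every edge. By
`around_vertex` it is then constant around each vertex, and connectedness carries the value along
edges to all flags. -/
lemma eq_of_classBoundary_eq_zero (hG : G.Connected) {S : M.Face → ZMod 2}
    (hS : classBoundary M.face S = 0) (f g : G.Flag) : S (M.face f) = S (M.face g) := by
  have hside : ∀ f : G.Flag, S (M.face f.flipSide) = S (M.face f) := by
    intro f
    have h0 := congrFun hS f.edge
    rw [classBoundary_apply, Pi.zero_apply, CharTwo.add_eq_zero] at h0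
    rw [Flag.apply_eq_apply_edgeFlag M.face_flipEnd f,
      Flag.apply_eq_apply_edgeFlag M.face_flipEnd f.flipSide]
    change S (M.face (edgeFlag f.edge !f.1.2.2)) = _
    cases f.1.2.2
    · exact h0.symm
    · exact h0
  have hvert : ∀ f g : G.Flag, f.vertex = g.vertex → S (M.face g) = S (M.face f) := by
    intro f g hfg
    have := M.around_vertex f g hfg
    clear hfg
    induction this with
    | refl => rfl
    | tail _ h ih =>
      rw [← ih]
      rcases h with rfl | rfl
      · rw [M.face_turn]
      · exact hside _
  have hreach := hG.2 g.vertex g.2.vertex_mem f.vertex f.2.vertex_mem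
  have key : ∀ y, G.Reaches g.vertex y → ∀ f : G.Flag, f.vertex = y →
      S (M.face f) = S (M.face g) := by
    intro y hy
    induction hy with
    | refl => exact fun f hf ↦ hvert g f hf.symm
    | @tail a b _ hab ih =>
      obtain ⟨e, he⟩ := hab
      intro f hf
      let f' : G.Flag := ⟨(e, a, false), he.inc_left⟩
      have h1 := ih f' rfl
      have h2 : f'.flipEnd.vertex = b := f'.isLink_vertex_flipEnd.right_unique he
      rw [← h1, ← M.face_flipEnd f']
      exact hvert _ _ (h2.trans hf.symm)
  exact key _ hreach f rfl

lemma card_face_le [Fintype E(G)] [Fintype M.Face] (hG : G.Connected) :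
    Fintype.card M.Face ≤
      Module.finrank (ZMod 2) (LinearMap.range (classBoundary M.face)) + 1 := by
  have h1 := (classBoundary M.face).finrank_range_add_finrank_ker
  rw [Module.finrank_fintype_fun_eq_card] at h1
  have h2 : LinearMap.ker (classBoundary M.face) ≤ Submodule.span (ZMod 2) {fun _ ↦ 1} := by
    intro S hS
    rw [LinearMap.mem_ker] at hS
    rw [Submodule.mem_span_singleton]
    by_cases hne : Nonempty G.Flag
    · obtain ⟨f⟩ := hne
      refine ⟨S (M.face f), ?_⟩
      ext q
      obtain ⟨g, rfl⟩ := M.exists_face_eq q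
      rw [Pi.smul_apply, smul_eq_mul, mul_one]
      exact M.eq_of_classBoundary_eq_zero hG hS f g
    · refine ⟨0, ?_⟩
      ext q
      obtain ⟨g, rfl⟩ := M.exists_face_eq q
      exact absurd ⟨g⟩ hne
  have h3 := (Submodule.finrank_mono h2).trans (finrank_span_le_card _)
  simp only [Set.toFinset_singleton, Finset.card_singleton] at h3
  omega

/-- The relation that generates the faces after the deletion of the edges in `D`. -/
def MergeRel (D : Set E(G)) (a b : G.Flag) : Prop :=
  b = M.turn a ∨ b = a.flipEnd ∨ (a.edge ∈ D ∧ b = a.flipSide)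

/-- The faces after the deletion of the edges in `D`. -/
def MergedFace (D : Set E(G)) : Type (max u v) := Quot (M.MergeRel D)

/-- The merged face of a flag. -/
def mergedFace (D : Set E(G)) (f : G.Flag) : M.MergedFace D := Quot.mk _ f

lemma mergedFace_flipEnd (D : Set E(G)) (f : G.Flag) :
    M.mergedFace D f.flipEnd = M.mergedFace D f :=
  Eq.symm <| Quot.sound (r := M.MergeRel D) (a := f) (Or.inr (Or.inl rfl))

lemma mergedFace_turn (D : Set E(G)) (f : G.Flag) :
    M.mergedFace D (M.turn f) = M.mergedFace D f :=
  Eq.symm <| Quot.sound (r := M.MergeRel D) (a := f) (Or.inl rfl)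

lemma classBoundary_mergedFace_mem (D : Set E(G)) (S : M.MergedFace D → ZMod 2) :
    classBoundary (M.mergedFace D) S ∈ vanishingOn D := by
  intro e he
  rw [classBoundary_apply, CharTwo.add_eq_zero]
  exact congrArg S (Quot.sound (Or.inr (Or.inr ⟨he, rfl⟩)))

/-- If the boundary of a union of faces avoids `D`, then `S` agrees on both sides of each edge of
`D` and so descends to the merged faces. -/
lemma range_classBoundary_inf_le (D : Set E(G)) :
    LinearMap.range (classBoundary M.face) ⊓ vanishingOn D ≤
      LinearMap.range (classBoundary (M.mergedFace D)) := by
  rintro _ ⟨⟨S, rfl⟩, hS⟩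
  refine ⟨Quot.lift (fun f ↦ S (M.face f)) ?_, ?_⟩
  · rintro a b (rfl | rfl | ⟨ha, rfl⟩)
    · rw [M.face_turn]
    · rw [M.face_flipEnd]
    · have h0 := hS a.edge ha
      rw [classBoundary_apply, CharTwo.add_eq_zero] at h0
      rw [Flag.apply_eq_apply_edgeFlag M.face_flipEnd a,
        Flag.apply_eq_apply_edgeFlag M.face_flipEnd a.flipSide]
      change _ = S (M.face (edgeFlag a.edge !a.1.2.2))
      cases a.1.2.2
      · exact h0
      · exact h0.symm
  · rfl

end CellularEmbedding

end FaceBoundary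

end Graph

/-! ### Cycles restricted to the edges of a complete model -/

namespace Graph

variable {α : Type u} {β : Type v} {G : Graph α β}

section CompleteModelEdges

open Classical

/-- A model of a complete graph together with a choice of an edge between any two branch sets:
`e i j` joins `a i j` in the `i`-th branch set to `a j i` in the `j`-th. -/
structure EdgeModel (G : Graph α β) (r : ℕ) where
  B : Fin r → Set α
  e : Fin r → Fin r → E(G)
  a : Fin r → Fin r → α
  connectedOn : ∀ i, ConnectedOn G.Adj (B i)
  subset : ∀ i, B i ⊆ V(G)
  eq_of_mem : ∀ i j x, x ∈ B i → x ∈ B j → i = j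
  symm : ∀ i j, e i j = e j i
  mem : ∀ i j, i ≠ j → a i j ∈ B i
  isLink : ∀ i j, i ≠ j → G.IsLink (e i j) (a i j) (a j i)

lemma HasCompleteModel.exists_edgeModel {r : ℕ} (h : G.HasCompleteModel r)
    (hE : E(G).Nonempty) : Nonempty (G.EdgeModel r) := by
  obtain ⟨B, hBV, hBne, hBc, hBd, hBa⟩ := h
  obtain ⟨e₀, he₀⟩ := hE
  have hedge : ∀ i j, ∃ (e : E(G)) (x y : α), i ≠ j → x ∈ B i ∧ y ∈ B j ∧ G.IsLink e x y := by
    intro i j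
    by_cases hij : i = j
    · obtain ⟨x, -⟩ := hBne i
      exact ⟨⟨e₀, he₀⟩, x, x, fun h ↦ absurd hij h⟩
    · obtain ⟨x, hx, y, hy, e, he⟩ := hBa i j hij
      exact ⟨⟨e, he.edge_mem⟩, x, y, fun _ ↦ ⟨hx, hy, he⟩⟩
  choose e x y h using hedge
  -- The choice made for `i < j` serves both orders, which makes `e` symmetric. The diagonal takes
  -- an arbitrary edge, which is why some edge must exist.
  refine ⟨⟨B, fun i j ↦ if i < j then e i j else if j < i then e j i else ⟨e₀, he₀⟩,
    fun i j ↦ if i < j then x i j else y j i, hBc, hBV, ?_, ?_, ?_, ?_⟩⟩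
  · intro i j z hi hj
    by_contra hij
    exact Set.disjoint_left.1 (hBd i j hij) hi hj
  · intro i j
    rcases lt_trichotomy i j with hij | rfl | hij
    · simp [hij, hij.not_gt]
    · simp
    · simp [hij, hij.not_gt]
  · intro i j hij
    rcases lt_or_gt_of_ne hij with h1 | h1
    · simpa [h1] using (h i j hij).1
    · simpa [h1, h1.not_gt] using (h j i hij.symm).2.1
  · intro i j hij
    rcases lt_or_gt_of_ne hij with h1 | h1
    · simpa [h1, h1.not_gt] using (h i j hij).2.2
    · simpa [h1, h1.not_gt] using (h j i hij.symm).2.2.symm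

namespace EdgeModel

variable {r : ℕ} (m : G.EdgeModel r)

lemma inc_left {i j : Fin r} (hij : i ≠ j) : G.Inc (m.e i j) (m.a i j) :=
  (m.isLink i j hij).inc_left

lemma eq_or_eq_of_inc {i j k : Fin r} (hij : i ≠ j) {x : α} (hx : G.Inc (m.e i j) x)
    (hk : x ∈ m.B k) : k = i ∨ k = j := by
  rcases hx.eq_or_eq_of_isLink (m.isLink i j hij) with rfl | rfl
  · exact .inl (m.eq_of_mem _ _ _ hk (m.mem i j hij))
  · exact .inr (m.eq_of_mem _ _ _ hk (m.mem j i hij.symm))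

lemma eq_and_eq_or_of_e_eq {i j k l : Fin r} (hij : i ≠ j) (hkl : k ≠ l)
    (h : m.e i j = m.e k l) : (i = k ∧ j = l) ∨ (i = l ∧ j = k) := by
  have h1 : i = k ∨ i = l := m.eq_or_eq_of_inc hkl (h ▸ m.inc_left hij) (m.mem i j hij)
  have h2 : j = k ∨ j = l := m.eq_or_eq_of_inc hkl (h ▸ (m.isLink i j hij).inc_right)
    (m.mem j i hij.symm)
  omega

/-- The edges that are neither inside a branch set nor chosen to join two branch sets. -/
def otherEdges : Set E(G) :=
  {f | (∀ i j, i ≠ j → f ≠ m.e i j) ∧ ∀ i, ∃ x, G.Inc f x ∧ x ∉ m.B i}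

/-- The restriction to the chosen edges between branch sets. -/
def restrict : (E(G) → ZMod 2) →ₗ[ZMod 2] (Fin r × Fin r → ZMod 2) where
  toFun z p := if p.1 = p.2 then 0 else z (m.e p.1 p.2)
  map_add' z w := by ext p; simp only [Pi.add_apply]; split_ifs <;> simp
  map_smul' c z := by
    ext p
    simp only [Pi.smul_apply, smul_eq_mul, RingHom.id_apply]
    split_ifs <;> simp

lemma restrict_apply (z : E(G) → ZMod 2) (i j : Fin r) :
    m.restrict z (i, j) = if i = j then 0 else z (m.e i j) := rfl

lemma restrict_symm (z : E(G) → ZMod 2) (i j : Fin r) :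
    m.restrict z (i, j) = m.restrict z (j, i) := by
  rw [restrict_apply, restrict_apply, m.symm i j]
  simp only [eq_comm]

/-- The triangle through three branch sets. -/
lemma exists_triangle [Fintype E(G)] [G.Loopless] {i j k : Fin r} (hij : i ≠ j) (hik : i ≠ k)
    (hjk : j ≠ k) : ∃ z ∈ LinearMap.ker G.boundary ⊓ vanishingOn m.otherEdges,
      ∀ l n, l ≠ i → n ≠ i → l ≠ n → z (m.e l n) = if m.e l n = m.e j k then 1 else 0 := by
  obtain ⟨p, hp, hpb⟩ := ConnectedOn.exists_boundary_eq (m.connectedOn i) (m.mem i j hij)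
    (m.mem i k hik)
  obtain ⟨q, hq, hqb⟩ := ConnectedOn.exists_boundary_eq (m.connectedOn j) (m.mem j i hij.symm)
    (m.mem j k hjk)
  obtain ⟨t, ht, htb⟩ := ConnectedOn.exists_boundary_eq (m.connectedOn k) (m.mem k i hik.symm)
    (m.mem k j hjk.symm)
  have hzero : ∀ (i : Fin r) (p : E(G) → ZMod 2),
      (∀ (f : E(G)) (w : α), G.Inc f w → w ∉ m.B i → p f = 0) →
      ∀ l n, l ≠ n → p (m.e l n) = 0 := by
    intro i p hp l n hln
    by_cases hl : l = i
    · refine hp _ _ (m.isLink l n hln).inc_right fun hmem ↦ hln ?_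
      rw [hl]
      exact (m.eq_of_mem _ _ _ hmem (m.mem n l hln.symm))
    · exact hp _ _ (m.inc_left hln) fun hmem ↦ hl (m.eq_of_mem _ _ _ (m.mem l n hln) hmem)
  -- Three chosen edges are closed up by paths inside the three branch sets. These paths contain no
  -- chosen edge, so away from `i` the only chosen edge used is `m.e j k`.
  refine ⟨Pi.single (m.e i j) 1 + Pi.single (m.e j k) 1 + Pi.single (m.e k i) 1 + p + q + t,
    ⟨?_, ?_⟩, ?_⟩
  · rw [SetLike.mem_coe, LinearMap.mem_ker]
    simp only [map_add, hpb, hqb, htb, boundary_single _ (m.isLink i j hij),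
      boundary_single _ (m.isLink j k hjk), boundary_single _ (m.isLink k i hik.symm)]
    ext x
    simp only [Pi.add_apply, Pi.zero_apply]
    have h2 : (2 : ZMod 2) = 0 := rfl
    linear_combination (G.vertexIndicator (m.a i j) x + G.vertexIndicator (m.a j i) x +
      G.vertexIndicator (m.a j k) x + G.vertexIndicator (m.a k j) x +
      G.vertexIndicator (m.a k i) x + G.vertexIndicator (m.a i k) x) * h2
  · rintro f ⟨hf, hfB⟩
    have hB : ∀ (i : Fin r) (p : E(G) → ZMod 2),
        (∀ (f : E(G)) (w : α), G.Inc f w → w ∉ m.B i → p f = 0) → p f = 0 := by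
      intro i p hp
      obtain ⟨x, hx, hxB⟩ := hfB i
      exact hp f x hx hxB
    simp only [Pi.add_apply, hB i p hp, hB j q hq, hB k t ht, Pi.single_eq_of_ne (hf i j hij),
      Pi.single_eq_of_ne (hf j k hjk), Pi.single_eq_of_ne (hf k i hik.symm), add_zero]
  · intro l n hl hn hln
    have h1 : m.e l n ≠ m.e i j := fun h ↦ by
      have := m.eq_and_eq_or_of_e_eq hln hij h
      omega
    have h2 : m.e l n ≠ m.e k i := fun h ↦ by
      have := m.eq_and_eq_or_of_e_eq hln hik.symm h
      omega
    simp only [Pi.add_apply, hzero i p hp l n hln, hzero j q hq l n hln, hzero k t ht l n hln,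
      Pi.single_eq_of_ne h1, Pi.single_eq_of_ne h2, add_zero, zero_add]
    rw [Pi.single_apply]

/-- The restriction of a cycle to the chosen edges has even degree at every branch set. -/
lemma sum_restrict_eq_zero [Fintype E(G)] [Fintype V(G)] [G.Loopless] {z : E(G) → ZMod 2}
    (hz : z ∈ LinearMap.ker G.boundary ⊓ vanishingOn m.otherEdges) (i : Fin r) :
    ∑ j, m.restrict z (i, j) = 0 := by
  obtain ⟨hzb, hzv⟩ := hz
  rw [SetLike.mem_coe, LinearMap.mem_ker] at hzb
  -- The boundary of `z` is summed over the vertices of `B i`. An edge inside `B i` counts twice and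
  -- cancels, the other edges carry the value 0, and a chosen edge at `B i` counts once.
  have hdeg : ∀ f : E(G), ∑ x : V(G), (if x.1 ∈ m.B i then if G.Inc f x then z f else 0 else 0) =
      ∑ j, if i ≠ j ∧ f = m.e i j then z f else 0 := by
    intro f
    obtain ⟨x, y, hxy⟩ := G.exists_isLink_of_mem_edgeSet f.2
    have hne := hxy.ne
    have hlhs : ∑ v : V(G), (if v.1 ∈ m.B i then if G.Inc f v then z f else 0 else 0) =
        (if x ∈ m.B i then z f else 0) + if y ∈ m.B i then z f else 0 := by
      rw [Finset.sum_eq_add (⟨x, hxy.left_mem⟩ : V(G)) ⟨y, hxy.right_mem⟩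
        (fun h ↦ hne (congrArg Subtype.val h)) ?_ (by simp) (by simp)]
      · simp only [hxy.inc_left, hxy.inc_right, if_true]
      · rintro v - ⟨hv1, hv2⟩
        have hinc : ¬ G.Inc f v := fun hv ↦ by
          rcases Inc.eq_or_eq_of_isLink hv hxy with h | h
          · exact hv1 (Subtype.ext h)
          · exact hv2 (Subtype.ext h)
        rw [if_neg hinc, ite_self]
    rw [hlhs]
    by_cases hf : ∃ k l, k ≠ l ∧ f = m.e k l
    · obtain ⟨k, l, hkl, rfl⟩ := hf
      wlog hx : x = m.a k l generalizing k l
      · have hlk := m.symm k l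
        rcases hxy.left_eq_or_eq (m.isLink k l hkl) with h | h
        · exact absurd h hx
        · have := this l k hkl.symm (by rwa [← hlk]) (by rwa [← hlk]) h
          rwa [← hlk] at this
      subst hx
      have hy : y = m.a l k := hxy.right_unique (m.isLink k l hkl)
      subst hy
      have hx : m.a k l ∈ m.B i ↔ k = i :=
        ⟨fun h ↦ m.eq_of_mem _ _ _ (m.mem k l hkl) h, fun h ↦ h ▸ m.mem k l hkl⟩
      have hy : m.a l k ∈ m.B i ↔ l = i :=
        ⟨fun h ↦ m.eq_of_mem _ _ _ (m.mem l k hkl.symm) h, fun h ↦ h ▸ m.mem l k hkl.symm⟩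
      rw [hx, hy]
      have hiff : ∀ j, (i ≠ j ∧ m.e k l = m.e i j) ↔ (k = i ∧ l = j) ∨ (l = i ∧ k = j) := by
        intro j
        constructor
        · rintro ⟨hij, h⟩
          have := m.eq_and_eq_or_of_e_eq hkl hij h
          omega
        · rintro (⟨rfl, rfl⟩ | ⟨rfl, rfl⟩)
          · exact ⟨hkl, rfl⟩
          · exact ⟨hkl.symm, m.symm _ _⟩
      simp only [hiff]
      by_cases hk : k = i
      · have hl : l ≠ i := fun h ↦ hkl (hk.trans h.symm)
        simp [hk, hl]
      · simp [hk]
        by_cases hl : l = i <;> simp [hl]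
    · push Not at hf
      have hrhs : ∑ j, (if i ≠ j ∧ f = m.e i j then z f else 0) = 0 :=
        Finset.sum_eq_zero fun j _ ↦ if_neg fun h ↦ hf i j h.1 h.2
      rw [hrhs]
      by_cases hB : ∀ k, ∃ x, G.Inc f x ∧ x ∉ m.B k
      · rw [hzv f ⟨hf, hB⟩]
        simp
      · push Not at hB
        obtain ⟨k, hk⟩ := hB
        have hx := hk x hxy.inc_left
        have hy := hk y hxy.inc_right
        by_cases hki : k = i
        · subst hki
          rw [if_pos hx, if_pos hy, CharTwo.add_self_eq_zero]
        · rw [if_neg fun h ↦ hki (m.eq_of_mem _ _ _ hx h),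
            if_neg fun h ↦ hki (m.eq_of_mem _ _ _ hy h), add_zero]
  calc ∑ j, m.restrict z (i, j)
      = ∑ j, ∑ f : E(G), if i ≠ j ∧ f = m.e i j then z f else 0 := by
        refine Finset.sum_congr rfl fun j _ ↦ ?_
        rw [restrict_apply]
        by_cases hij : i = j
        · simp [hij]
        · simp [hij]
    _ = ∑ f : E(G), ∑ j, if i ≠ j ∧ f = m.e i j then z f else 0 := Finset.sum_comm
    _ = ∑ f : E(G), ∑ x : V(G), if x.1 ∈ m.B i then if G.Inc f x then z f else 0 else 0 :=
        Finset.sum_congr rfl fun f _ ↦ (hdeg f).symm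
    _ = ∑ x : V(G), ∑ f : E(G), if x.1 ∈ m.B i then if G.Inc f x then z f else 0 else 0 :=
        Finset.sum_comm
    _ = ∑ x : V(G), if x.1 ∈ m.B i then G.boundary z x else 0 := by
        refine Finset.sum_congr rfl fun x _ ↦ ?_
        rw [boundary_apply]
        split_ifs <;> simp
    _ = 0 := by simp [hzb]

/-- A nonzero restriction of a cycle contains at least three edges, each counted twice here. -/
lemma six_le_card_support [Fintype E(G)] [Fintype V(G)] [G.Loopless] {z : E(G) → ZMod 2}
    (hz : z ∈ LinearMap.ker G.boundary ⊓ vanishingOn m.otherEdges) (hne : m.restrict z ≠ 0) :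
    6 ≤ (Finset.univ.filter fun p ↦ m.restrict z p ≠ 0).card := by
  have hdiag : ∀ i j, m.restrict z (i, j) ≠ 0 → i ≠ j := by
    rintro i _ h rfl
    exact h (by simp [restrict_apply])
  have hstep : ∀ i j, m.restrict z (i, j) ≠ 0 → ∃ k, k ≠ j ∧ m.restrict z (i, k) ≠ 0 := by
    intro i j hij
    by_contra! hcon
    have := m.sum_restrict_eq_zero hz i
    rw [Finset.sum_eq_single j (fun k _ hk ↦ hcon k hk) (by simp)] at this
    exact hij this
  obtain ⟨⟨i, j⟩, hij⟩ := Function.ne_iff.1 hne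
  rw [Pi.zero_apply] at hij
  have hji : m.restrict z (j, i) ≠ 0 := by rwa [m.restrict_symm]
  obtain ⟨k, hkj, hik⟩ := hstep i j hij
  obtain ⟨l, hli, hjl⟩ := hstep j i hji
  have hki : m.restrict z (k, i) ≠ 0 := by rwa [m.restrict_symm]
  have hlj : m.restrict z (l, j) ≠ 0 := by rwa [m.restrict_symm]
  have h1 := hdiag _ _ hij
  have h2 := hdiag _ _ hik
  have h3 := hdiag _ _ hjl
  -- An edge `ij` of the support continues at both ends, to `k ≠ j` and `l ≠ i`. The three edges are
  -- distinct even if `k = l`.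
  have hsub : ({(i, j), (j, i), (i, k), (k, i), (j, l), (l, j)} : Finset (Fin r × Fin r)) ⊆
      Finset.univ.filter fun p ↦ m.restrict z p ≠ 0 := by
    intro p hp
    simp only [Finset.mem_insert, Finset.mem_singleton] at hp
    refine Finset.mem_filter.2 ⟨Finset.mem_univ _, ?_⟩
    rcases hp with rfl | rfl | rfl | rfl | rfl | rfl <;> assumption
  refine le_trans (le_of_eq ?_) (Finset.card_le_card hsub)
  rw [Finset.card_insert_of_notMem, Finset.card_insert_of_notMem, Finset.card_insert_of_notMem,
    Finset.card_insert_of_notMem, Finset.card_insert_of_notMem, Finset.card_singleton] <;>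
  · simp only [Finset.mem_insert, Finset.mem_singleton, Prod.mk.injEq, not_or]
    omega

end EdgeModel

end CompleteModelEdges

end Graph

/-! ### Dimension count for complete models on a surface -/

namespace Graph

variable {α : Type u} {β : Type v} {G : Graph α β}

section Genus

open Classical

lemma card_filter_lt_mul_two (m : ℕ) :
    (Finset.univ.filter fun p : Fin m × Fin m ↦ p.1 < p.2).card * 2 = m * (m - 1) := by
  rw [Finset.card_filter, Fintype.sum_prod_type_right]
  have : ∀ j : Fin m, (∑ i : Fin m, if (i, j).1 < (i, j).2 then 1 else 0) = (j : ℕ) := by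
    intro j
    rw [← Finset.card_filter]
    simp only [Finset.filter_gt_eq_Iio, Fin.card_Iio]
  simp only [this]
  rw [Fin.sum_univ_eq_sum_range (fun i ↦ i) m, Finset.sum_range_id_mul_two]

namespace EdgeModel

lemma card_le_finrank_map [Fintype E(G)] [G.Loopless] {k : ℕ} (m : G.EdgeModel (k + 1)) :
    (Finset.univ.filter fun p : Fin k × Fin k ↦ p.1 < p.2).card ≤ Module.finrank (ZMod 2)
      ((LinearMap.ker G.boundary ⊓ vanishingOn m.otherEdges).map m.restrict) := by
  let Q := {p : Fin k × Fin k // p.1 < p.2}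
  let ρ : (Fin (k + 1) × Fin (k + 1) → ZMod 2) →ₗ[ZMod 2] (Q → ZMod 2) :=
    LinearMap.funLeft (ZMod 2) (ZMod 2) fun q ↦ (q.1.1.succ, q.1.2.succ)
  -- The triangle through branch sets `0`, `j`, `k` restricts to the unit vector at `(j, k)` among
  -- the pairs that avoid `0`, so these triangles are independent.
  have htop : ((LinearMap.ker G.boundary ⊓ vanishingOn m.otherEdges).map m.restrict).map ρ = ⊤ := by
    rw [eq_top_iff]
    intro x _
    rw [pi_eq_sum_univ' x]
    refine Submodule.sum_mem _ fun q _ ↦ Submodule.smul_mem _ _ ?_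
    have hq := q.2
    obtain ⟨z, hz, hzq⟩ := m.exists_triangle (i := 0) (j := q.1.1.succ) (k := q.1.2.succ)
      (Fin.succ_ne_zero _).symm (Fin.succ_ne_zero _).symm
      (fun h ↦ hq.ne (Fin.succ_injective _ h))
    refine ⟨_, ⟨z, hz, rfl⟩, ?_⟩
    ext p
    have hp := p.2
    have hne : p.1.1.succ ≠ p.1.2.succ := fun h ↦ hp.ne (Fin.succ_injective _ h)
    change m.restrict z (p.1.1.succ, p.1.2.succ) = _
    rw [restrict_apply, if_neg hne, hzq _ _ (Fin.succ_ne_zero _) (Fin.succ_ne_zero _) hne,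
      Pi.single_apply]
    by_cases hpq : p = q
    · rw [hpq]
      simp
    · rw [if_neg, if_neg hpq]
      intro h
      refine hpq (Subtype.ext ?_)
      rcases m.eq_and_eq_or_of_e_eq hne (fun h ↦ hq.ne (Fin.succ_injective _ h)) h with h | h
      · exact Prod.ext (Fin.succ_injective _ h.1) (Fin.succ_injective _ h.2)
      · rw [← Fin.succ_injective _ h.1, ← Fin.succ_injective _ h.2] at hq
        exact absurd hq hp.not_gt
  have h1 := Submodule.finrank_map_le ρ
    ((LinearMap.ker G.boundary ⊓ vanishingOn m.otherEdges).map m.restrict)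
  rw [htop, finrank_top, Module.finrank_fintype_fun_eq_card, Fintype.card_subtype] at h1
  exact h1

/-- The rank is at most the number of merged faces with nonzero restricted boundary. Each of them
contains at least six ordered pairs, and each ordered pair lies on at most two merged faces. -/
lemma finrank_map_faces_le [Fintype E(G)] [Fintype V(G)] [G.Loopless] {r : ℕ} (m : G.EdgeModel r)
    (M : G.CellularEmbedding) [Fintype (M.MergedFace m.otherEdges)] :
    Module.finrank (ZMod 2) ((LinearMap.range (classBoundary M.face) ⊓
      vanishingOn m.otherEdges).map m.restrict) * 6 ≤ (r * r - r) * 2 := by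
  let T := m.restrict ∘ₗ classBoundary (M.mergedFace m.otherEdges)
  have h1 : Module.finrank (ZMod 2) ((LinearMap.range (classBoundary M.face) ⊓
      vanishingOn m.otherEdges).map m.restrict) ≤ Module.finrank (ZMod 2) (LinearMap.range T) := by
    rw [LinearMap.range_comp]
    exact Submodule.finrank_mono (Submodule.map_mono (M.range_classBoundary_inf_le _))
  have h2 := T.finrank_range_le_card_ne_zero
  have h3 := Finset.card_mul_le_card_mul (s := Finset.univ.filter fun q ↦ T (Pi.single q 1) ≠ 0)
    (t := (Finset.univ : Finset (Fin r)).offDiag) (fun q p ↦ T (Pi.single q 1) p ≠ 0)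
    (m := 6) (n := 2) ?_ ?_
  · rw [Finset.offDiag_card, Finset.card_univ, Fintype.card_fin] at h3
    exact (Nat.mul_le_mul_right 6 (h1.trans h2)).trans h3
  · intro q hq
    refine (m.six_le_card_support (z := classBoundary (M.mergedFace m.otherEdges) (Pi.single q 1))
      ⟨?_, M.classBoundary_mergedFace_mem _ _⟩ (Finset.mem_filter.1 hq).2).trans
        (Finset.card_le_card ?_)
    · exact M.boundary_classBoundary (M.mergedFace_flipEnd _) (M.mergedFace_turn _) _
    · rintro ⟨i, j⟩ hp
      have hp' := (Finset.mem_filter.1 hp).2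
      refine Finset.mem_filter.2 ⟨?_, hp'⟩
      simp only [Finset.mem_offDiag, Finset.mem_univ, true_and]
      rintro rfl
      exact hp' (by simp [restrict_apply])
  · rintro ⟨i, j⟩ hp
    have hij : i ≠ j := (Finset.mem_offDiag.1 hp).2.2
    refine (Finset.card_le_card (t := {M.mergedFace m.otherEdges (edgeFlag (m.e i j) false),
      M.mergedFace m.otherEdges (edgeFlag (m.e i j) true)}) ?_).trans Finset.card_le_two
    intro q hq
    have hq' := (Finset.mem_filter.1 hq).2
    simp only [Finset.mem_insert, Finset.mem_singleton]
    by_contra! hcon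
    refine hq' ?_
    change m.restrict (classBoundary _ _) (i, j) = 0
    rw [restrict_apply, if_neg hij, classBoundary_apply, Pi.single_eq_of_ne hcon.1.symm,
      Pi.single_eq_of_ne hcon.2.symm, add_zero]

end EdgeModel

/-- In the orientable case the division in `genus` rounds down, which without the parity of the
Euler characteristic costs one. -/
lemma CellularEmbedding.eulerChar_ge_of_genus_le (M : G.CellularEmbedding) {g : ℕ}
    (h : M.genus ≤ g) : 1 - 2 * (g : ℤ) ≤ M.eulerChar := by
  unfold genus at h
  split_ifs at h <;> omega

/-- Graphs of genus at most `g` have no model of `K_r` for `r = 12 g + 8`. -/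
theorem HasGenusAtMost.not_hasCompleteModel {g : ℕ} (hG : G.IsFiniteMultigraph)
    (h : G.HasGenusAtMost g) : ¬ G.HasCompleteModel (12 * g + 7 + 1) := by
  intro hmodel
  obtain ⟨M, hM⟩ := h
  have hE : E(G).Nonempty := by
    obtain ⟨B, -, -, -, -, hadj⟩ := hmodel
    obtain ⟨x, -, y, -, e, he⟩ := hadj 0 1 (by simp)
    exact ⟨e, he.edge_mem⟩
  obtain ⟨m⟩ := hmodel.exists_edgeModel hE
  have : Fintype E(G) := hG.finite_edgeSet.fintype
  have : Fintype V(G) := hG.finite_vertexSet.fintype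
  have : G.Loopless := hG.loopless
  have hflag : Finite G.Flag := by
    refine Finite.of_injective (β := E(G) × V(G) × Bool)
      (fun f ↦ (f.edge, ⟨f.vertex, f.2.vertex_mem⟩, f.1.2.2)) fun f f' hff' ↦ ?_
    simp only [Prod.mk.injEq] at hff'
    exact Subtype.ext (Prod.ext (congrArg Subtype.val hff'.1)
      (Prod.ext (congrArg Subtype.val hff'.2.1) hff'.2.2))
  have : Finite M.Face := Quot.finite _
  have : Finite (M.MergedFace m.otherEdges) := Quot.finite _
  have : Fintype M.Face := Fintype.ofFinite _
  have : Fintype (M.MergedFace m.otherEdges) := Fintype.ofFinite _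
  have hχ := M.eulerChar_ge_of_genus_le hM
  rw [CellularEmbedding.eulerChar, CellularEmbedding.faceCount, if_neg hE.ne_empty,
    Nat.card_eq_fintype_card, ← Nat.card_coe_set_eq V(G), ← Nat.card_coe_set_eq E(G),
    Nat.card_eq_fintype_card, Nat.card_eq_fintype_card] at hχ
  have hsub : LinearMap.range (classBoundary M.face) ≤ LinearMap.ker G.boundary := by
    rintro _ ⟨S, rfl⟩
    exact M.boundary_classBoundary M.face_flipEnd M.face_turn S
  -- With `h2`, `h3` and `hχ`, the face boundaries have codimension at most `2 - χ ≤ 2 * g + 1` in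
  -- the cycle space, and by `h1` the same bound holds after deletion and restriction.
  have h1 := Submodule.finrank_map_inf_add_le hsub (vanishingOn m.otherEdges) m.restrict
  have h2 := hG.connected.finrank_ker_boundary_add_le
  have h3 := M.card_face_le hG.connected
  have h4 := m.card_le_finrank_map
  have h5 := m.finrank_map_faces_le M
  -- The count would give `72 * g ^ 2 + 78 * g + 21` at most `(144 * g ^ 2 + 180 * g + 56) / 3 + 2 *
  -- g + 1`, which fails for every `g`.
  have h6 := card_filter_lt_mul_two (12 * g + 7)
  have h7 : (12 * g + 7 + 1) * (12 * g + 7 + 1) - (12 * g + 7 + 1) =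
      (12 * g + 7 + 1) * (12 * g + 7) := by rw [← Nat.mul_sub_one]; simp
  rw [h7] at h5
  rw [show 12 * g + 7 - 1 = 12 * g + 6 by omega] at h6
  have h8 : (12 * g + 7 + 1) * (12 * g + 7) = 144 * (g * g) + 180 * g + 56 := by ring
  have h9 : (12 * g + 7) * (12 * g + 6) = 144 * (g * g) + 156 * g + 42 := by ring
  rw [h8] at h5
  rw [h9] at h6
  omega

end Genus

end Graph

end

theorem corollary6p5 :
    -- graphs without a `K_r` minor
    (∀ r Δ : ℕ, ∃ C : ℝ, ∀ (α : Type u) (β : Type v) (G : Graph α β),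
      G.IsFiniteMultigraph → ¬ G.HasCompleteMinor r → (∀ x ∈ V(G), G.degree x ≤ Δ) →
      ∃ k : ℕ, G.scrambleNumber = k ∧ (k : ℝ) ≤ C * √(V(G).ncard : ℝ)) ∧
    -- planar graphs
    (∀ Δ : ℕ, ∃ C : ℝ, ∀ (α : Type u) (β : Type v) (G : Graph α β),
      G.IsFiniteMultigraph → G.IsPlanar → (∀ x ∈ V(G), G.degree x ≤ Δ) →
      ∃ k : ℕ, G.scrambleNumber = k ∧ (k : ℝ) ≤ C * √(V(G).ncard : ℝ)) ∧
    -- graphs of bounded genus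
    (∀ g Δ : ℕ, ∃ C : ℝ, ∀ (α : Type u) (β : Type v) (G : Graph α β),
      G.IsFiniteMultigraph → G.HasGenusAtMost g → (∀ x ∈ V(G), G.degree x ≤ Δ) →
      ∃ k : ℕ, G.scrambleNumber = k ∧ (k : ℝ) ≤ C * √(V(G).ncard : ℝ)) := by
  refine ⟨fun r Δ ↦ ?_, fun Δ ↦ ?_, fun g Δ ↦ ?_⟩
  · obtain ⟨C, hC⟩ := Graph.scrambleNumber_le_of_not_hasCompleteModel r Δ
    exact ⟨C, fun α β G hG hr hΔ ↦ hC α β G hG (fun h ↦ hr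
      (h.hasCompleteMinor hG.finite_vertexSet hG.finite_edgeSet hG.loopless)) hΔ⟩
  · obtain ⟨C, hC⟩ := Graph.scrambleNumber_le_of_not_hasCompleteModel 5 Δ
    exact ⟨C, fun α β G hG hp hΔ ↦ hC α β G hG hp.not_hasCompleteModel hΔ⟩
  · obtain ⟨C, hC⟩ := Graph.scrambleNumber_le_of_not_hasCompleteModel (12 * g + 7 + 1) Δ
    exact ⟨C, fun α β G hG hg hΔ ↦ hC α β G hG (hg.not_hasCompleteModel hG) hΔ⟩
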